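/- **Setting.** Let $(\mathsf X,\mathcal X)$ be a measurable space with countably generated $\sigma$-field, $(\mathsf Y,\mathcal Y)$ a measurable space, $Q$ a Markov kernel on $\mathsf X$, $\nu$ a $\sigma$-finite measure on $\mathsf Y$, and $g:\mathsf X\times\mathsf Y\to[0,\infty)$ measurable with $\int g(x,y)\,\nu(dy)=1$ for all $x$. Put $g_y=g(\cdot,y)$. For $y_k,\dots,y_m\in\mathsf Y$ let $L\langle y_{k:m}\rangle$ be the kernel $$L\langle y_{k:m}\rangle(x_k,A)=\int\!\cdots\!\int \mathbf 1_A(x_{m+1})\prod_{\ell=k}^m g(x_\ell,y_\ell)\,Q(x_\ell,dx_{\ell+1}),$$ with $L\langle y_{k:m}\rangle(x,\cdot)=\delta_x$ if $k>m$. Write $\chi Lf=\iint f(x')\,L(x,dx')\,\chi(dx)$, $\mathbf 1=\mathbf 1_{\mathsf X}$, let $\|\cdot\|_\infty$ be the supremum norm, and set $$\Delta_{\chi,\chi'}\langle y_{k:m}\rangle(f,h)=\chi L\langle y_{k:m}\rangle f\cdot\chi' L\langle y_{k:m}\rangle h-\chi L\langle y_{k:m}\rangle h\cdot\chi' L\langle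 y_{k:m}\rangle f .$$ Let $(Y_n)_{n\in\mathbb Z}$ be a $\mathsf Y$-valued process on a probability space $(\Omega,\mathcal A,\mathbb P)$. For $r\ge1$, a measurable set $C\subseteq\mathsf X$ is *$r$-local Doeblin* if there are positive functions $\epsilon_C^-,\epsilon_C^+$ on $\mathsf Y^r$, probability measures $\lambda_C\langle z\rangle$ with $\lambda_C\langle z\rangle(C)=1$, and positive functions $\varphi_C\langle z\rangle$ on $\mathsf X$ ($z\in\mathsf Y^r$) such that for all $z\in\mathsf Y^r$, $x\in C$ and $A\in\mathcal X$, $$\epsilon_C^-\langle z\rangle\varphi_C\langle z\rangle(x)\lambda_C\langle z\rangle(A)\le L\langle z\rangle(x,A\cap C)\le\epsilon_C^+\langle z\rangle\varphi_C\langle z\rangle(x)\lambda_C\langle z\rangle(A).$$ **Assumptions.** Fix an integer $r\ge1$, a measurable set $K\subseteq\mathsf Y^r$ and a non-empty measurable set $D\subseteq\mathsf X$. (A1) $(Y_n)_{n\in\mathbb Z}$ is strictly stationary and ergodic, and: (i) the process $Z_n=Y_{nr:(n+1)r-1}$, $n\in\mathbb Z$, is ergodic and $\mathbb P(Z_0\in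 K)>2/3$; (ii) for every $\eta>0$ there is an $r$-local Doeblin set $C$ such that $\sup_{x\in C^c}L\langle z\rangle(x,\mathsf X)\le\eta\,\|L\langle z\rangle\mathbf 1\|_\infty<\infty$ for all $z\in K$, and $\inf_{z\in K}\epsilon_C^-\langle z\rangle/\epsilon_C^+\langle z\rangle>0$; (iii) $\mathbb E[\ln^-\inf_{x\in D}L\langle Y_{0:r-1}\rangle(x,D)]<\infty$. (A2) $g(x,y)>0$ for all $(x,y)$, and $\mathbb E[\ln^+\|g_{Y_0}\|_\infty]<\infty$. (The expectations in (A1)(iii) and (A2) are understood to be well defined, that is, the functions of $Y_{0:r-1}$ and of $Y_0$ in them are measurable up to null sets of the laws of these variables.) Let $\mathcal M(D,r)$ be the set of probability measures $\chi$ on $\mathsf X$ with $\mathbb E[\ln^-\chi L\langle Y_{0:\ell-1}\rangle\mathbf 1_D]<\infty$ for all $\ell\in\{0,\dots,r\}$, where $\ln^-0=\infty$. Let $\mathcal P\langle y_{-m:k}\rangle(\chi)$ be the set of probability measures $\tilde\chi$ on $\mathsf X$ with $\|g_{y_k}\|_\infty\,\tilde\chi L\langle y_{-m:k-1}\rangle\mathbf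 1\ge\tfrac12\,\chi L\langle y_{-m:k}\rangle\mathbf 1$. **Proposition.** Assume (A1)–(A2). Then, almost surely, $\chi L\langle Y_{j:j+n-1}\rangle\mathbf 1$ and $\|L\langle Y_{j:j+n-1}\rangle\mathbf 1\|_\infty$ are positive and finite for all $j\in\mathbb Z$, $n\ge0$ and all probability measures $\chi$ on $\mathsf X$ (so the expressions below are well defined), and there is a constant $\beta\in(0,1)$ such that the following hold. (i) For all $\chi,\chi'\in\mathcal M(D,r)$ there is an almost surely finite random variable $C_{\chi,\chi'}$ such that, almost surely, for all integers $k\ge1$, $m\ge0$ and all $\tilde\chi\in\mathcal P\langle Y_{-m:k}\rangle(\chi)$, $$\ln\frac{\tilde\chi L\langle Y_{-m:k}\rangle\mathbf 1}{\tilde\chi L\langle Y_{-m:k-1}\rangle\mathbf 1}-\ln\frac{\chi' L\langle Y_{-m:k}\rangle\mathbf 1}{\chi' L\langle Y_{-m:k-1}\rangle\mathbf 1}\le C_{\chi,\chi'}\,\beta^{k+m}.$$ (ii) For every $\chi\in\mathcal M(D,r)$ there is an almost surely finite random variable $C_\chi$ such that, almost surely, for all integers $k\ge1$, $m\ge0$,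 $$\left|\ln\frac{\chi L\langle Y_{-m:k}\rangle\mathbf 1}{\chi L\langle Y_{-m:k-1}\rangle\mathbf 1}-\ln\frac{\chi L\langle Y_{-m-1:k}\rangle\mathbf 1}{\chi L\langle Y_{-m-1:k-1}\rangle\mathbf 1}\right|\le C_\chi\,\beta^{k+m}.$$ (iii) There is an almost surely finite random variable $C$ such that, almost surely, for all integers $m\ge1$, all probability measures $\chi,\chi'$ on $\mathsf X$ and all bounded measurable $h:\mathsf X\to\mathbb R$, $$\frac{|\Delta_{\chi,\chi'}\langle Y_{-m:-1}\rangle(h,\mathbf 1)|}{\|L\langle Y_{-m:-1}\rangle\mathbf 1\|_\infty^2}\le C\,\beta^m\,\|h\|_\infty.$$ -/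

import Mathlib

open MeasureTheory ProbabilityTheory
open scoped ENNReal NNReal

/-- `ln⁺` on `[0, ∞]`, with `ln⁺ ∞ = ∞`. -/
noncomputable def logPlus (x : ℝ≥0∞) : ℝ≥0∞ := (ENNReal.log x).toENNReal

/-- `ln⁻` on `[0, ∞]`, with `ln⁻ 0 = ∞`. -/
noncomputable def logMinus (x : ℝ≥0∞) : ℝ≥0∞ := (-ENNReal.log x).toENNReal

/-- The vector `(y_j, …, y_{j+n-1})`; it is empty for `n = 0`. -/
def block {E : Type*} (y : ℤ → E) (j : ℤ) (n : ℕ) : Fin n → E := fun i => y (j + (i : ℕ))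

/-- A process indexed by `ℤ` is strictly stationary and ergodic: the shift of sequences preserves
its law on path space and is ergodic for it. -/
def IsStationaryErgodic {Ω E : Type*} [MeasurableSpace Ω] [MeasurableSpace E]
    (P : Measure Ω) (V : ℤ → Ω → E) : Prop :=
  Ergodic (fun (u : ℤ → E) (n : ℤ) => u (n + 1)) (P.map (fun ω n => V n ω))

/-- `E[f(V)] < ∞` for a nonnegative function `f`. As `f` may be a supremum or an infimum over an
uncountable set, that the expectation makes sense (measurability of `f` up to null sets of the law
of `V`) is part of the definition. -/
def HasFiniteExpectation {Ω E : Type*} [MeasurableSpace Ω] [MeasurableSpace E]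
    (P : Measure Ω) (V : Ω → E) (f : E → ℝ≥0∞) : Prop :=
  AEMeasurable f (P.map V) ∧ ∫⁻ ω, f (V ω) ∂P < ∞

/-- A hidden Markov model: a Markov transition kernel `Q` on `X`, and an observation kernel from
`X` to `S` that has the density `y ↦ g x y` with respect to a `σ`-finite measure `ν`. -/
structure HMM (X S : Type*) [MeasurableSpace X] [MeasurableSpace S] where
  Q : Kernel X X
  isMarkovKernel_Q : IsMarkovKernel Q
  ν : Measure S
  sigmaFinite_ν : SigmaFinite ν
  g : X → S → ℝ≥0
  measurable_g : Measurable (Function.uncurry g)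
  lintegral_g : ∀ x, ∫⁻ y, (g x y : ℝ≥0∞) ∂ν = 1

namespace HMM

attribute [instance] HMM.isMarkovKernel_Q HMM.sigmaFinite_ν

variable {X S Ω : Type*} [MeasurableSpace X] [MeasurableSpace S] [MeasurableSpace Ω]

/-- `‖g_y‖_∞`. -/
noncomputable def supG (M : HMM X S) (y : S) : ℝ≥0∞ := ⨆ x, (M.g x y : ℝ≥0∞)

/-- The one-step unnormalized kernel `L⟨y⟩(x, dx') = g(x, y) Q(x, dx')`. -/
noncomputable def step (M : HMM X S) (y : S) : Kernel X X where
  toFun x := (M.g x y : ℝ≥0∞) • M.Q x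
  measurable' := by
    refine Measure.measurable_of_measurable_coe _ fun s hs => ?_
    have h1 : Measurable fun x => (M.g x y : ℝ≥0∞) :=
      (M.measurable_g.comp measurable_prodMk_right).coe_nnreal_ennreal
    exact h1.mul (M.Q.measurable_coe hs)

/-- The unnormalized kernel
`L⟨z⟩(x_0, A) = ∫ ⋯ ∫ 1_A(x_n) ∏_{i < n} g(x_i, z_i) Q(x_i, dx_{i+1})`; for `n = 0` it is the
identity kernel `δ_x`. -/
noncomputable def lkh (M : HMM X S) : {n : ℕ} → (Fin n → S) → Kernel X X
  | 0, _ => Kernel.id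
  | _ + 1, z => (M.lkh (Fin.tail z)) ∘ₖ (M.step (z 0))

/-- The measure `χ L⟨z⟩`. -/
noncomputable def push (M : HMM X S) (χ : ProbabilityMeasure X) {n : ℕ} (z : Fin n → S) :
    Measure X :=
  (χ : Measure X).bind (M.lkh z)

/-- The likelihood `χ L⟨z⟩ 1_X`. -/
noncomputable def lik (M : HMM X S) (χ : ProbabilityMeasure X) {n : ℕ} (z : Fin n → S) : ℝ≥0∞ :=
  M.push χ z Set.univ

/-- `‖L⟨z⟩ 1_X‖_∞`. -/
noncomputable def supLkh (M : HMM X S) {n : ℕ} (z : Fin n → S) : ℝ≥0∞ :=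
  ⨆ x, M.lkh z x Set.univ

/-- The logarithm of the one-step predictive likelihood,
`ln (χ L⟨z_0, …, z_n⟩ 1_X / χ L⟨z_0, …, z_{n-1}⟩ 1_X)`. -/
noncomputable def logPredLik (M : HMM X S) (χ : ProbabilityMeasure X) {n : ℕ}
    (z : Fin (n + 1) → S) : ℝ :=
  Real.log ((M.lik χ z).toReal / (M.lik χ (Fin.init z)).toReal)

/-- `Δ_{χ,χ'}⟨z⟩(f, h) = χ L⟨z⟩ f · χ' L⟨z⟩ h - χ L⟨z⟩ h · χ' L⟨z⟩ f`. -/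
noncomputable def Delta (M : HMM X S) (χ χ' : ProbabilityMeasure X) {n : ℕ} (z : Fin n → S)
    (f h : X → ℝ) : ℝ :=
  (∫ x, f x ∂(M.push χ z)) * (∫ x, h x ∂(M.push χ' z)) -
    (∫ x, h x ∂(M.push χ z)) * (∫ x, f x ∂(M.push χ' z))

/-- The set `𝒫⟨z_0, …, z_n⟩(χ)` of the probability measures `χ̃` such that
`‖g_{z_n}‖_∞ · χ̃ L⟨z_0, …, z_{n-1}⟩ 1_X ≥ (1/2) χ L⟨z_0, …, z_n⟩ 1_X`. -/
def nearSet (M : HMM X S) {n : ℕ} (z : Fin (n + 1) → S) (χ : ProbabilityMeasure X) :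
    Set (ProbabilityMeasure X) :=
  {χt | (1 / 2 : ℝ≥0∞) * M.lik χ z ≤ M.supG (z (Fin.last n)) * M.lik χt (Fin.init z)}

/-- `C` is an `r`-local Doeblin set, with functions `εm = ε⁻`, `εp = ε⁺`, `lam = λ` and `φ`. -/
structure IsLocalDoeblin (M : HMM X S) (r : ℕ) (C : Set X) (εm εp : (Fin r → S) → ℝ≥0)
    (lam : (Fin r → S) → ProbabilityMeasure X) (φ : (Fin r → S) → X → ℝ≥0) : Prop where
  measurableSet : MeasurableSet C
  εm_pos : ∀ z, 0 < εm z
  εp_pos : ∀ z, 0 < εp z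
  φ_pos : ∀ z x, 0 < φ z x
  lam_C : ∀ z, (lam z : Measure X) C = 1
  lower : ∀ z, ∀ x ∈ C, ∀ A, MeasurableSet A →
    (εm z : ℝ≥0∞) * φ z x * (lam z : Measure X) A ≤ M.lkh z x (A ∩ C)
  upper : ∀ z, ∀ x ∈ C, ∀ A, MeasurableSet A →
    M.lkh z x (A ∩ C) ≤ (εp z : ℝ≥0∞) * φ z x * (lam z : Measure X) A

/-- Assumption (A1), for the integer `r` and the sets `K` and `D`. -/
structure AssumptionA1 (M : HMM X S) (P : Measure Ω) (Y : ℤ → Ω → S) (r : ℕ)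
    (K : Set (Fin r → S)) (D : Set X) : Prop where
  stationaryErgodic : IsStationaryErgodic P Y
  r_pos : 0 < r
  measurableSet_K : MeasurableSet K
  blockErgodic :
    IsStationaryErgodic P (fun (n : ℤ) ω => block (fun j => Y j ω) (n * (r : ℤ)) r)
  prob_K : 2 / 3 < P {ω | block (fun j => Y j ω) 0 r ∈ K}
  localDoeblin : ∀ η : ℝ≥0, 0 < η → ∃ C εm εp lam φ, M.IsLocalDoeblin r C εm εp lam φ ∧
    (∀ z ∈ K, (⨆ x ∈ Cᶜ, M.lkh z x Set.univ) ≤ η * M.supLkh z ∧ M.supLkh z < ∞) ∧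
    0 < ⨅ z ∈ K, (εm z : ℝ≥0∞) / (εp z : ℝ≥0∞)
  measurableSet_D : MeasurableSet D
  nonempty_D : D.Nonempty
  minoration : HasFiniteExpectation P (fun ω => block (fun j => Y j ω) 0 r)
    (fun z => logMinus (⨅ x ∈ D, M.lkh z x D))

/-- Assumption (A2). -/
structure AssumptionA2 (M : HMM X S) (P : Measure Ω) (Y : ℤ → Ω → S) : Prop where
  g_pos : ∀ x y, 0 < M.g x y
  supG : HasFiniteExpectation P (Y 0) (fun y => logPlus (M.supG y))

/-- The class `ℳ(D, r)` of the probability measures `χ` such that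
`E[ln⁻ χ L⟨Y_0, …, Y_{ℓ-1}⟩ 1_D] < ∞` for all `ℓ ∈ {0, …, r}`. -/
def initClass (M : HMM X S) (P : Measure Ω) (Y : ℤ → Ω → S) (D : Set X) (r : ℕ) :
    Set (ProbabilityMeasure X) :=
  {χ | ∀ l : ℕ, l ≤ r → ∫⁻ ω, logMinus (M.push χ (block (fun j => Y j ω) 0 l) D) ∂P < ∞}

end HMM

/-!
Along a window of observations, `χ L a · χ' L b - χ L b · χ' L a` is the integral of the
antisymmetric function `a x * b x' - b x * a x'` against the likelihoods of a pair of independent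
copies of the chain. Over two successive blocks in `K`, the part of the mass of the pair that visits
a local Doeblin set `C` in both copies contracts such functions by a factor `ρ < 1`, because there
the kernel is comparable to a rank-one kernel and the symmetric part cancels; the part that leaves
`C × C` is small, since leaving `C` costs a factor `η`. By the ergodic theorem fewer than one third
of the blocks lie outside `K`, so that either many contractions or many factors `η` occur. The total
mass grows at most, and by the minoration on `D` decays at most, exponentially, at a rate that does
not depend on `η`; taking `η` small enough makes the second alternative negligible as well.
Logarithms of predictive likelihoods are then compared through the corresponding cross terms, and
the finitely many windows that are too short for these estimates are absorbed in the random
constants.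
-/

/-- The maximum over `k ≤ n` of the Birkhoff sums `∑_{i < k} g (T^i x)`, by recursion on `n`: this
is the function `M_n` in the proof of the maximal ergodic theorem. -/
noncomputable def birkhoffMax {A : Type*} (T : A → A) (g : A → ℝ) : ℕ → A → ℝ
  | 0, _ => 0
  | n + 1, x => max 0 (g x + birkhoffMax T g n (T x))

section BirkhoffMax

variable {A : Type*} {T : A → A} {g : A → ℝ}

lemma birkhoffMax_nonneg (n : ℕ) (x : A) : 0 ≤ birkhoffMax T g n x := by
  cases n <;> simp [birkhoffMax]

lemma monotone_birkhoffMax (x : A) : Monotone fun n => birkhoffMax T g n x := by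
  refine monotone_nat_of_le_succ fun n => ?_
  induction n generalizing x with
  | zero => exact birkhoffMax_nonneg 1 x
  | succ n ih =>
    simp only [birkhoffMax] at ih ⊢
    gcongr
    exact ih (T x)

lemma birkhoffSum_le_birkhoffMax (n : ℕ) (x : A) :
    birkhoffSum T g n x ≤ birkhoffMax T g n x := by
  induction n generalizing x with
  | zero => simp [birkhoffMax]
  | succ n ih =>
    rw [birkhoffSum_succ', birkhoffMax]
    exact le_max_of_le_right (by gcongr; exact ih (T x))

lemma birkhoffMax_succ_sub_birkhoffMax (n : ℕ) (x : A) :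
    birkhoffMax T g (n + 1) x - birkhoffMax T g n (T x) = max (-birkhoffMax T g n (T x)) (g x) := by
  rw [birkhoffMax, ← max_sub_sub_right, zero_sub, add_sub_cancel_right]

lemma bddAbove_birkhoffMax_apply_iff (x : A) :
    BddAbove (Set.range fun n => birkhoffMax T g n (T x)) ↔
      BddAbove (Set.range fun n => birkhoffMax T g n x) := by
  simp only [bddAbove_def, Set.forall_mem_range]
  constructor
  · rintro ⟨c, hc⟩
    refine ⟨max 0 (g x + c), fun n => (monotone_birkhoffMax x n.le_succ).trans ?_⟩
    simp only [birkhoffMax]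
    gcongr
    exact hc n
  · rintro ⟨c, hc⟩
    refine ⟨c - g x, fun n => ?_⟩
    linarith [hc (n + 1), le_max_right 0 (g x + birkhoffMax T g n (T x)),
      show birkhoffMax T g (n + 1) x = max 0 (g x + birkhoffMax T g n (T x)) from rfl]

lemma eventually_max_neg_birkhoffMax_eq {x : A}
    (hx : ¬ BddAbove (Set.range fun n => birkhoffMax T g n x)) :
    ∀ᶠ n in Filter.atTop, max (-birkhoffMax T g n (T x)) (g x) = g x := by
  rw [← bddAbove_birkhoffMax_apply_iff, not_bddAbove_iff] at hx
  obtain ⟨_, ⟨N, rfl⟩, hN⟩ := hx (-g x)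
  filter_upwards [Filter.eventually_ge_atTop N] with n hn
  exact max_eq_right (neg_le.1 (hN.le.trans (monotone_birkhoffMax (T x) hn)))

variable [MeasurableSpace A]

lemma measurable_birkhoffMax (hT : Measurable T) (hg : Measurable g) (n : ℕ) :
    Measurable (birkhoffMax T g n) := by
  induction n with
  | zero => exact measurable_const
  | succ n ih => exact measurable_const.max (hg.add (ih.comp hT))

variable {μ : Measure A}

lemma integrable_birkhoffMax (hT : MeasurePreserving T μ μ) (hg : Integrable g μ) (n : ℕ) :
    Integrable (birkhoffMax T g n) μ := by
  induction n with
  | zero => exact integrable_zero _ _ _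
  | succ n ih =>
    exact (integrable_zero _ _ _).sup (hg.add (hT.integrable_comp_of_integrable ih))

lemma integral_max_neg_birkhoffMax_nonneg (hT : MeasurePreserving T μ μ) (hgm : Measurable g)
    (hg : Integrable g μ) (n : ℕ) :
    0 ≤ ∫ x, max (-birkhoffMax T g n (T x)) (g x) ∂μ := by
  have hM := integrable_birkhoffMax hT hg
  have hcomp : ∫ x, birkhoffMax T g n (T x) ∂μ = ∫ x, birkhoffMax T g n x ∂μ := by
    rw [← integral_map hT.aemeasurable
      (measurable_birkhoffMax hT.measurable hgm n).aestronglyMeasurable, hT.map_eq]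
  have hMT : Integrable (fun x => birkhoffMax T g n (T x)) μ :=
    hT.integrable_comp_of_integrable (hM n)
  simp_rw [← birkhoffMax_succ_sub_birkhoffMax]
  rw [integral_sub (hM _) hMT, hcomp, sub_nonneg]
  exact integral_mono (hM _) (hM _) fun x => monotone_birkhoffMax x n.le_succ

/- If the partial maxima were unbounded, then `max (-M_n ∘ T) g = M_{n+1} - M_n ∘ T`, whose integral
is nonnegative, would converge to `g`. -/
theorem ae_bddAbove_birkhoffMax (hT : Ergodic T μ) (hgm : Measurable g) (hg : Integrable g μ)
    (hneg : ∫ x, g x ∂μ < 0) : ∀ᵐ x ∂μ, BddAbove (Set.range fun n => birkhoffMax T g n x) := by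
  have hTm := hT.toMeasurePreserving
  have hMm := measurable_birkhoffMax hTm.measurable hgm
  refine (hT.toPreErgodic.ae_mem_or_ae_notMem (measurableSet_bddAbove_range hMm)
    (Set.ext bddAbove_birkhoffMax_apply_iff)).resolve_right fun hunbdd => ?_
  have hlim : Filter.Tendsto (fun n => ∫ x, max (-birkhoffMax T g n (T x)) (g x) ∂μ)
      Filter.atTop (nhds (∫ x, g x ∂μ)) := by
    refine tendsto_integral_of_dominated_convergence (fun x => |g x|)
      (fun n => (((hMm n).comp hTm.measurable).neg.max hgm).aestronglyMeasurable) hg.abs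
      (fun n => Filter.Eventually.of_forall fun x => ?_) ?_
    · rw [Real.norm_eq_abs, abs_le]
      have hM := birkhoffMax_nonneg (T := T) (g := g) n (T x)
      exact ⟨le_max_of_le_right (neg_abs_le _),
        max_le (by linarith [abs_nonneg (g x)]) (le_abs_self _)⟩
    · filter_upwards [hunbdd] with x hx
      exact tendsto_nhds_of_eventually_eq (eventually_max_neg_birkhoffMax_eq hx)
  exact hneg.not_ge (ge_of_tendsto' hlim (integral_max_neg_birkhoffMax_nonneg hTm hgm hg))

theorem exists_birkhoffSum_le_of_integral_lt [IsProbabilityMeasure μ] (hT : Ergodic T μ)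
    {f : A → ℝ} (hfm : Measurable f) (hf : Integrable f μ) {c : ℝ} (hc : ∫ x, f x ∂μ < c) :
    ∃ C : A → ℝ, Measurable C ∧ ∀ᵐ x ∂μ, ∀ n : ℕ, birkhoffSum T f n x ≤ c * n + C x := by
  have hgm : Measurable fun x => f x - c := hfm.sub_const c
  have hneg : ∫ x, (f x - c) ∂μ < 0 := by
    rw [integral_sub hf (integrable_const c)]
    simpa using hc
  refine ⟨fun x => ⨆ n, birkhoffMax T (fun x => f x - c) n x,
    Measurable.iSup (measurable_birkhoffMax hT.measurable hgm), ?_⟩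
  filter_upwards [ae_bddAbove_birkhoffMax hT hgm (hf.sub (integrable_const c)) hneg] with x hx n
  have hsup := (birkhoffSum_le_birkhoffMax n x).trans (le_ciSup hx n)
  have hsum : birkhoffSum T (fun x => f x - c) n x = birkhoffSum T f n x - c * n := by
    simp [birkhoffSum, Finset.sum_sub_distrib, mul_comm]
  linarith

end BirkhoffMax

section Shift

variable {E : Type*}

/-- The sequence `(u_{n+i})_n`, that is, the two-sided sequence `u` seen from the time `i`. -/
def shiftSeq (i : ℤ) (u : ℤ → E) : ℤ → E := fun n => u (n + i)

lemma shiftSeq_shiftSeq (i j : ℤ) (u : ℤ → E) :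
    shiftSeq i (shiftSeq j u) = shiftSeq (i + j) u := by
  ext n; simp [shiftSeq, add_assoc]

lemma iterate_shiftSeq (i : ℤ) (k : ℕ) : (shiftSeq (E := E) i)^[k] = shiftSeq (k * i) := by
  induction k with
  | zero => ext u n; simp [shiftSeq]
  | succ k ih =>
    ext1 u
    rw [Function.iterate_succ_apply', ih, shiftSeq_shiftSeq]
    congr 1; push_cast; ring

lemma birkhoffSum_shiftSeq (i : ℤ) (F : (ℤ → E) → ℝ) (n : ℕ) (u : ℤ → E) :
    birkhoffSum (shiftSeq i) F n u = ∑ k ∈ Finset.range n, F (shiftSeq (k * i) u) := by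
  simp only [birkhoffSum, iterate_shiftSeq]

lemma sum_range_add_int (F : ℤ → ℝ) (p q : ℕ) :
    ∑ i ∈ Finset.range (p + q), F (-(p : ℤ) + i) =
      ∑ i ∈ Finset.range p, F (-1 - (i : ℤ)) + ∑ i ∈ Finset.range q, F i := by
  rw [Finset.sum_range_add, ← Finset.sum_range_reflect]
  congr 1
  · refine Finset.sum_congr rfl fun i hi => ?_
    rw [Finset.mem_range] at hi
    congr 1; omega
  · refine Finset.sum_congr rfl fun i _ => ?_
    congr 1; push_cast; ring

variable [MeasurableSpace E]

lemma measurable_shiftSeq (i : ℤ) : Measurable (shiftSeq (E := E) i) :=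
  measurable_pi_lambda _ fun n => measurable_pi_apply (n + i)

/-- The shift of two-sided sequences, as a measurable equivalence; it gives access to the
ergodicity of the inverse of the shift. -/
def shiftEquiv (E : Type*) [MeasurableSpace E] : (ℤ → E) ≃ᵐ (ℤ → E) where
  toFun := shiftSeq 1
  invFun := shiftSeq (-1)
  left_inv u := by ext n; simp [shiftSeq]
  right_inv u := by ext n; simp [shiftSeq]
  measurable_toFun := measurable_shiftSeq 1
  measurable_invFun := measurable_shiftSeq (-1)

section PathSpace

variable {μ : Measure (ℤ → E)}

lemma ergodic_shiftSeq_neg_one (h : Ergodic (shiftSeq 1) μ) : Ergodic (shiftSeq (-1)) μ :=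
  Ergodic.symm (e := shiftEquiv E) h

lemma measurePreserving_shiftSeq (h : Ergodic (shiftSeq 1) μ) (i : ℤ) :
    MeasurePreserving (shiftSeq i) μ μ := by
  obtain ⟨k, rfl | rfl⟩ := i.eq_nat_or_neg
  · have hk := h.toMeasurePreserving.iterate k
    rwa [iterate_shiftSeq, mul_one] at hk
  · have hk := (ergodic_shiftSeq_neg_one h).toMeasurePreserving.iterate k
    rwa [iterate_shiftSeq, mul_neg_one] at hk

variable [IsProbabilityMeasure μ]

lemma exists_sum_shiftSeq_le_of_integral_lt (h : Ergodic (shiftSeq 1) μ) {F : (ℤ → E) → ℝ}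
    (hFm : Measurable F) (hF : Integrable F μ) {c : ℝ} (hc : ∫ u, F u ∂μ < c) :
    ∃ C : (ℤ → E) → ℝ, Measurable C ∧ ∀ᵐ u ∂μ, ∀ p q : ℕ,
      ∑ i ∈ Finset.range (p + q), F (shiftSeq (-(p : ℤ) + i) u) ≤ c * (p + q) + C u := by
  obtain ⟨C₁, hC₁, hfuture⟩ := exists_birkhoffSum_le_of_integral_lt h hFm hF hc
  obtain ⟨C₂, hC₂, hpast⟩ :=
    exists_birkhoffSum_le_of_integral_lt (ergodic_shiftSeq_neg_one h) hFm hF hc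
  refine ⟨fun u => C₁ u + C₂ (shiftSeq (-1) u),
    hC₁.add (hC₂.comp (measurable_shiftSeq (-1))), ?_⟩
  filter_upwards [hfuture,
    (measurePreserving_shiftSeq h (-1)).quasiMeasurePreserving.ae hpast] with u hq hp p q
  have hq := hq q
  have hp := hp p
  simp only [birkhoffSum_shiftSeq, shiftSeq_shiftSeq, mul_one, mul_neg_one, neg_add_eq_sub] at hq hp
  rw [sum_range_add_int fun i => F (shiftSeq i u)]
  simp only [sub_eq_add_neg, add_comm] at hp hq ⊢
  linarith

theorem exists_sum_shiftSeq_le_of_lintegral_lt (h : Ergodic (shiftSeq 1) μ)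
    {f : (ℤ → E) → ℝ≥0∞} (hf : AEMeasurable f μ) {c : ℝ}
    (hc : ∫⁻ u, f u ∂μ < ENNReal.ofReal c) :
    ∃ C : (ℤ → E) → ℝ, Measurable C ∧ ∀ᵐ u ∂μ, (∀ i : ℤ, f (shiftSeq i u) < ∞) ∧
      ∀ p q : ℕ, ∑ i ∈ Finset.range (p + q), (f (shiftSeq (-(p : ℤ) + i) u)).toReal
        ≤ c * (p + q) + C u := by
  rw [lintegral_congr_ae hf.ae_eq_mk] at hc
  have hm := hf.measurable_mk
  have hfin : ∫⁻ u, hf.mk f u ∂μ ≠ ∞ := (hc.trans ENNReal.ofReal_lt_top).ne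
  have hint : ∫ u, (hf.mk f u).toReal ∂μ < c := by
    rw [integral_toReal hm.aemeasurable (ae_lt_top hm hfin)]
    exact (ENNReal.lt_ofReal_iff_toReal_lt hfin).1 hc
  obtain ⟨C, hC, hsum⟩ := exists_sum_shiftSeq_le_of_integral_lt h hm.ennreal_toReal
    (integrable_toReal_of_lintegral_ne_top hm.aemeasurable hfin) hint
  have hmk : ∀ᵐ u ∂μ, ∀ i : ℤ, f (shiftSeq i u) = hf.mk f (shiftSeq i u) ∧
      hf.mk f (shiftSeq i u) < ∞ :=
    ae_all_iff.2 fun i => (measurePreserving_shiftSeq h i).quasiMeasurePreserving.ae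
      (hf.ae_eq_mk.and (ae_lt_top hm hfin))
  refine ⟨C, hC, ?_⟩
  filter_upwards [hsum, hmk] with u hu hi
  exact ⟨fun i => (hi i).1 ▸ (hi i).2, fun p q => by simpa only [(hi _).1] using hu p q⟩

lemma exists_lintegral_tsub_natCast_lt {A : Type*} [MeasurableSpace A] {μ : Measure A}
    {f : A → ℝ≥0∞} (hf : Measurable f) (hfin : ∫⁻ x, f x ∂μ ≠ ∞) {ε : ℝ≥0∞} (hε : 0 < ε) :
    ∃ N : ℕ, ∫⁻ x, (f x - N) ∂μ < ε := by
  have hlim : Filter.Tendsto (fun N : ℕ => ∫⁻ x, (f x - N) ∂μ) Filter.atTop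
      (nhds (∫⁻ _, 0 ∂μ)) := by
    refine tendsto_lintegral_of_dominated_convergence f (fun N => hf.sub measurable_const)
      (fun N => Filter.Eventually.of_forall fun x => tsub_le_self) hfin ?_
    filter_upwards [ae_lt_top hf hfin] with x hx
    obtain ⟨N, hN⟩ := ENNReal.exists_nat_gt hx.ne
    refine tendsto_nhds_of_eventually_eq ?_
    filter_upwards [Filter.eventually_ge_atTop N] with n hn
    exact tsub_eq_zero_of_le (hN.le.trans (by exact_mod_cast hn))
  rw [lintegral_zero] at hlim
  exact (hlim.eventually (gt_mem_nhds hε)).exists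

/- Apply the ergodic bound to `f - N` with `N` so large that its mean is less than `ε`, and keep
only one term of the sum. -/
theorem exists_shiftSeq_neg_le (h : Ergodic (shiftSeq 1) μ) {f : (ℤ → E) → ℝ≥0∞}
    (hf : Measurable f) (hfin : ∫⁻ u, f u ∂μ ≠ ∞) {ε : ℝ} (hε : 0 < ε) :
    ∃ C : (ℤ → E) → ℝ, Measurable C ∧ ∀ᵐ u ∂μ, ∀ m : ℕ,
      f (shiftSeq (-(m : ℤ)) u) ≤ ENNReal.ofReal (ε * m + C u) := by
  obtain ⟨N, hN⟩ := exists_lintegral_tsub_natCast_lt hf hfin (ENNReal.ofReal_pos.2 hε)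
  obtain ⟨C, hC, hsum⟩ := exists_sum_shiftSeq_le_of_lintegral_lt h
    (f := fun u => f u - N) (hf.sub measurable_const).aemeasurable hN
  refine ⟨fun u => C u + ε + N, (hC.add_const _).add_const _, ?_⟩
  filter_upwards [hsum] with u hu m
  have hterm : (f (shiftSeq (-(m : ℤ)) u) - N).toReal ≤ ε * m + (C u + ε) := by
    have hsingle := (Finset.single_le_sum (f := fun i : ℕ =>
      (f (shiftSeq (-(m : ℤ) + i) u) - N).toReal) (fun i _ => ENNReal.toReal_nonneg)
      (Finset.mem_range.2 m.succ_pos)).trans (hu.2 m 1)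
    simp only [Nat.cast_zero, add_zero, Nat.cast_one] at hsingle
    linarith
  calc f (shiftSeq (-(m : ℤ)) u) ≤ (f (shiftSeq (-(m : ℤ)) u) - N) + N := le_tsub_add
    _ ≤ ENNReal.ofReal (ε * m + (C u + ε)) + ENNReal.ofReal N := by
        rw [ENNReal.ofReal_natCast]
        gcongr
        exact (ENNReal.le_ofReal_iff_toReal_le (hu.1 _).ne
          (ENNReal.toReal_nonneg.trans hterm)).2 hterm
    _ = ENNReal.ofReal (ε * m + (C u + ε + N)) := by
        rw [← ENNReal.ofReal_add (ENNReal.toReal_nonneg.trans hterm) N.cast_nonneg, add_assoc]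

end PathSpace

variable {Ω : Type*} [MeasurableSpace Ω] {P : Measure Ω} {V : ℤ → Ω → E}

lemma IsStationaryErgodic.ergodic_shiftSeq (h : IsStationaryErgodic P V) :
    Ergodic (shiftSeq 1) (P.map fun ω n => V n ω) := h

lemma IsStationaryErgodic.map_eq (h : IsStationaryErgodic P V) (hV : ∀ n, Measurable (V n))
    (i : ℤ) : P.map (V i) = P.map (V 0) := by
  have hp : Measurable fun ω n => V n ω := measurable_pi_lambda _ hV
  have hmap (j : ℤ) : P.map (V j) = (P.map fun ω n => V n ω).map fun u => u j :=
    (Measure.map_map (measurable_pi_apply j) hp).symm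
  rw [hmap 0, ← (measurePreserving_shiftSeq h.ergodic_shiftSeq i).map_eq,
    Measure.map_map (measurable_pi_apply 0) (measurable_shiftSeq i), hmap i]
  congr 1
  ext u
  simp [shiftSeq]

variable [IsProbabilityMeasure P]

theorem IsStationaryErgodic.exists_sum_shiftSeq_le (h : IsStationaryErgodic P V)
    (hV : ∀ n, Measurable (V n)) {f : (ℤ → E) → ℝ≥0∞}
    (hf : AEMeasurable f (P.map fun ω n => V n ω)) {c : ℝ}
    (hc : ∫⁻ ω, f (fun n => V n ω) ∂P < ENNReal.ofReal c) :
    ∃ C : Ω → ℝ, Measurable C ∧ ∀ᵐ ω ∂P, (∀ i : ℤ, f (shiftSeq i fun n => V n ω) < ∞) ∧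
      ∀ p q : ℕ, ∑ i ∈ Finset.range (p + q), (f (shiftSeq (-(p : ℤ) + i) fun n => V n ω)).toReal
        ≤ c * (p + q) + C ω := by
  have hp : Measurable fun ω n => V n ω := measurable_pi_lambda _ hV
  have : IsProbabilityMeasure (P.map fun ω n => V n ω) :=
    Measure.isProbabilityMeasure_map hp.aemeasurable
  obtain ⟨C, hC, hsum⟩ := exists_sum_shiftSeq_le_of_lintegral_lt h.ergodic_shiftSeq hf
    (by rwa [lintegral_map' hf hp.aemeasurable])
  exact ⟨fun ω => C fun n => V n ω, hC.comp hp, ae_of_ae_map hp.aemeasurable hsum⟩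

theorem IsStationaryErgodic.exists_shiftSeq_neg_le (h : IsStationaryErgodic P V)
    (hV : ∀ n, Measurable (V n)) {f : (ℤ → E) → ℝ≥0∞} (hf : Measurable f)
    (hfin : ∫⁻ ω, f (fun n => V n ω) ∂P ≠ ∞) {ε : ℝ} (hε : 0 < ε) :
    ∃ C : Ω → ℝ, Measurable C ∧ ∀ᵐ ω ∂P, ∀ m : ℕ,
      f (shiftSeq (-(m : ℤ)) fun n => V n ω) ≤ ENNReal.ofReal (ε * m + C ω) := by
  have hp : Measurable fun ω n => V n ω := measurable_pi_lambda _ hV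
  have : IsProbabilityMeasure (P.map fun ω n => V n ω) :=
    Measure.isProbabilityMeasure_map hp.aemeasurable
  obtain ⟨C, hC, hsum⟩ := _root_.exists_shiftSeq_neg_le h.ergodic_shiftSeq hf
    (by rwa [lintegral_map hf hp]) hε
  exact ⟨fun ω => C fun n => V n ω, hC.comp hp, ae_of_ae_map hp.aemeasurable hsum⟩

end Shift

section Block

variable {E : Type*} (y : ℤ → E)

lemma tail_block (j : ℤ) (n : ℕ) : Fin.tail (block y j (n + 1)) = block y (j + 1) n := by
  ext i; simp only [Fin.tail, block, Fin.val_succ]; congr 1; push_cast; ring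

lemma init_block (j : ℤ) (n : ℕ) : Fin.init (block y j (n + 1)) = block y j n := by
  ext i; simp [Fin.init, block]

lemma block_apply_zero (j : ℤ) (n : ℕ) : block y j (n + 1) 0 = y j := by
  simp [block]

lemma block_apply_last (j : ℤ) (n : ℕ) : block y j (n + 1) (Fin.last n) = y (j + n) := by
  simp [block]

lemma block_shiftSeq (i j : ℤ) (n : ℕ) : block (shiftSeq i y) j n = block y (j + i) n := by
  ext k; simp only [block, shiftSeq]; congr 1; ring

lemma measurable_block [MeasurableSpace E] (j : ℤ) (n : ℕ) :
    Measurable fun y : ℤ → E => block y j n :=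
  measurable_pi_lambda _ fun i => measurable_pi_apply (j + (i : ℕ))

end Block

lemma lintegral_pos_of_forall_pos {X : Type*} [MeasurableSpace X] {μ : Measure X} [NeZero μ]
    {f : X → ℝ≥0∞} (hf : Measurable f) (hpos : ∀ x, 0 < f x) : 0 < ∫⁻ x, f x ∂μ := by
  rw [lintegral_pos_iff_support hf,
    Set.eq_univ_of_forall (s := Function.support f) fun x => (hpos x).ne']
  exact Measure.measure_univ_pos.2 (NeZero.ne μ)

namespace HMM

variable {X S : Type*} [MeasurableSpace X] [MeasurableSpace S]
  (M : HMM X S)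

lemma measurable_g_left (y : S) : Measurable fun x => (M.g x y : ℝ≥0∞) :=
  (M.measurable_g.comp measurable_prodMk_right).coe_nnreal_ennreal

lemma g_le_supG (x : X) (y : S) : (M.g x y : ℝ≥0∞) ≤ M.supG y :=
  le_iSup (fun x => (M.g x y : ℝ≥0∞)) x

lemma lintegral_step (y : S) (x : X) (f : X → ℝ≥0∞) :
    ∫⁻ x', f x' ∂M.step y x = M.g x y * ∫⁻ x', f x' ∂M.Q x :=
  lintegral_smul_measure _ f

lemma lkh_succ_apply {n : ℕ} (z : Fin (n + 1) → S) (x : X) {A : Set X} (hA : MeasurableSet A) :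
    M.lkh z x A = M.g x (z 0) * ∫⁻ x', M.lkh (Fin.tail z) x' A ∂M.Q x := by
  rw [lkh, Kernel.comp_apply' _ _ _ hA, lintegral_step]

lemma measurable_lkh_joint {n : ℕ} {A : Set X} (hA : MeasurableSet A) :
    Measurable fun p : (Fin n → S) × X => M.lkh p.1 p.2 A := by
  induction n with
  | zero =>
    exact (Kernel.measurable_coe (Kernel.id : Kernel X X) hA).comp measurable_snd
  | succ n ih =>
    simp_rw [M.lkh_succ_apply _ _ hA]
    have htail : Measurable fun z : Fin (n + 1) → S => Fin.tail z :=
      measurable_pi_lambda _ fun i => measurable_pi_apply i.succ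
    have hlkh : Measurable fun q : ((Fin (n + 1) → S) × X) × X => M.lkh (Fin.tail q.1.1) q.2 A :=
      ih.comp ((htail.comp (measurable_fst.comp measurable_fst)).prodMk measurable_snd)
    exact (M.measurable_g.comp (measurable_snd.prodMk
      ((measurable_pi_apply 0).comp measurable_fst))).coe_nnreal_ennreal.mul
        (Measurable.lintegral_kernel_prod_right' (κ := M.Q.comap Prod.snd measurable_snd) hlkh)

lemma push_apply (χ : ProbabilityMeasure X) {n : ℕ} (z : Fin n → S) {A : Set X}
    (hA : MeasurableSet A) : M.push χ z A = ∫⁻ x, M.lkh z x A ∂(χ : Measure X) :=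
  Measure.bind_apply hA (Kernel.measurable _).aemeasurable

lemma measurable_push (χ : ProbabilityMeasure X) {n : ℕ} {A : Set X} (hA : MeasurableSet A) :
    Measurable fun z : Fin n → S => M.push χ z A := by
  simp_rw [M.push_apply χ _ hA]
  exact (M.measurable_lkh_joint hA).lintegral_prod_right'

lemma measurable_lik (χ : ProbabilityMeasure X) {n : ℕ} :
    Measurable fun z : Fin n → S => M.lik χ z :=
  M.measurable_push χ MeasurableSet.univ

lemma measurable_logPredLik (χ : ProbabilityMeasure X) {n : ℕ} :
    Measurable fun z : Fin (n + 1) → S => M.logPredLik χ z := by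
  have hi : Measurable fun z : Fin (n + 1) → S => Fin.init z :=
    measurable_pi_lambda _ fun i => measurable_pi_apply i.castSucc
  exact Real.measurable_log.comp ((M.measurable_lik χ).ennreal_toReal.div
    ((M.measurable_lik χ).comp hi).ennreal_toReal)

/-- The function `L⟨y_j, …, y_{j+n-1}⟩ f`. -/
noncomputable def act (y : ℤ → S) (j : ℤ) (n : ℕ) (f : X → ℝ≥0∞) (x : X) : ℝ≥0∞ :=
  ∫⁻ x', f x' ∂M.lkh (block y j n) x

variable (y : ℤ → S)

lemma measurable_act (j : ℤ) (n : ℕ) {f : X → ℝ≥0∞} (hf : Measurable f) :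
    Measurable (M.act y j n f) :=
  hf.lintegral_kernel

lemma act_zero (j : ℤ) {f : X → ℝ≥0∞} (hf : Measurable f) : M.act y j 0 f = f := by
  ext x
  exact lintegral_dirac' x hf

lemma act_succ (j : ℤ) (n : ℕ) {f : X → ℝ≥0∞} (hf : Measurable f) (x : X) :
    M.act y j (n + 1) f x = M.g x (y j) * ∫⁻ x', M.act y (j + 1) n f x' ∂M.Q x := by
  rw [act, lkh, Kernel.lintegral_comp _ _ _ hf, lintegral_step, tail_block, block_apply_zero]
  rfl

lemma act_add (j : ℤ) (n m : ℕ) {f : X → ℝ≥0∞} (hf : Measurable f) :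
    M.act y j (n + m) f = M.act y j n (M.act y (j + n) m f) := by
  induction n generalizing j with
  | zero => rw [act_zero _ _ _ (M.measurable_act _ _ _ hf)]; simp
  | succ n ih =>
    ext x
    rw [show n + 1 + m = (n + m) + 1 by ring, act_succ _ _ _ _ hf,
      act_succ _ _ _ _ (M.measurable_act _ _ _ hf), ih]
    push_cast
    rw [show j + 1 + (n : ℤ) = j + (n + 1) by ring]

lemma act_one (j : ℤ) (n : ℕ) (x : X) :
    M.act y j n (fun _ => 1) x = M.lkh (block y j n) x Set.univ := by
  simp [act]

lemma act_const_mul (j : ℤ) (n : ℕ) (c : ℝ≥0∞) {f : X → ℝ≥0∞} (hf : Measurable f) (x : X) :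
    M.act y j n (fun x => c * f x) x = c * M.act y j n f x :=
  lintegral_const_mul c hf

lemma act_mono (j : ℤ) (n : ℕ) {f h : X → ℝ≥0∞} (hfh : ∀ x, f x ≤ h x) (x : X) :
    M.act y j n f x ≤ M.act y j n h x :=
  lintegral_mono hfh

lemma act_indicator (j : ℤ) (n : ℕ) {A : Set X} (hA : MeasurableSet A) (x : X) :
    M.act y j n (A.indicator 1) x = M.lkh (block y j n) x A :=
  lintegral_indicator_one hA

lemma act_step_one (j : ℤ) (x : X) : M.act y j 1 (fun _ => 1) x = M.g x (y j) := by
  rw [act_succ _ _ _ _ measurable_const, act_zero _ _ _ measurable_const]; simp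

lemma act_succ_one (j : ℤ) (n : ℕ) :
    M.act y j (n + 1) (fun _ => 1) = M.act y j n fun x => (M.g x (y (j + n)) : ℝ≥0∞) := by
  rw [act_add _ _ _ _ _ measurable_const]
  congr 1
  ext x
  exact M.act_step_one y _ x

/-- The weighted likelihood `μ L⟨y_j, …, y_{j+n-1}⟩ f`. -/
noncomputable def wlik (μ : Measure X) (j : ℤ) (n : ℕ) (f : X → ℝ≥0∞) : ℝ≥0∞ :=
  ∫⁻ x, M.act y j n f x ∂μ

lemma lintegral_push (χ : ProbabilityMeasure X) (j : ℤ) (n : ℕ) {f : X → ℝ≥0∞}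
    (hf : Measurable f) : ∫⁻ x, f x ∂M.push χ (block y j n) = M.wlik y χ j n f :=
  Measure.lintegral_bind (Kernel.measurable _).aemeasurable hf.aemeasurable

lemma lik_eq_wlik (χ : ProbabilityMeasure X) (j : ℤ) (n : ℕ) :
    M.lik χ (block y j n) = M.wlik y χ j n fun _ => 1 := by
  rw [← lintegral_push _ _ _ _ _ measurable_const, lintegral_one]; rfl

lemma lik_add (χ : ProbabilityMeasure X) (j : ℤ) (n m : ℕ) :
    M.lik χ (block y j (n + m)) =
      M.wlik y (M.push χ (block y j n)) (j + n) m fun _ => 1 := by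
  rw [lik_eq_wlik, wlik, act_add _ _ _ _ _ measurable_const, wlik,
    lintegral_push _ _ _ _ _ (M.measurable_act _ _ _ measurable_const)]
  rfl

/-- The product of the numbers `max 1 ‖g_{y_i}‖_∞` over the window `[j, j + n)`. -/
noncomputable def majorant (j : ℤ) (n : ℕ) : ℝ≥0∞ :=
  ∏ i ∈ Finset.range n, max 1 (M.supG (y (j + i)))

lemma majorant_add (j : ℤ) (n m : ℕ) :
    M.majorant y j (n + m) = M.majorant y j n * M.majorant y (j + n) m := by
  rw [majorant, Finset.prod_range_add]
  congr 1
  refine Finset.prod_congr rfl fun i _ => ?_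
  push_cast; rw [add_assoc]

lemma one_le_majorant (j : ℤ) (n : ℕ) : 1 ≤ M.majorant y j n :=
  Finset.one_le_prod' fun _ _ => le_max_left _ _

lemma majorant_one (j : ℤ) : M.majorant y j 1 = max 1 (M.supG (y j)) := by
  simp [majorant]

lemma supG_le_majorant (j : ℤ) : M.supG (y j) ≤ M.majorant y j 1 := by
  rw [majorant_one]; exact le_max_right _ _

lemma majorant_le_of_le {j j' : ℤ} {n n' : ℕ} (hj : j ≤ j') (hn : j' + n' ≤ j + n) :
    M.majorant y j' n' ≤ M.majorant y j n := by
  obtain ⟨k, rfl⟩ := Int.le.dest hj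
  obtain ⟨l, hl⟩ := Int.le.dest hn
  obtain rfl : n = k + n' + l := by omega
  rw [majorant_add, majorant_add]
  calc M.majorant y (j + k) n' = 1 * M.majorant y (j + k) n' * 1 := by simp
    _ ≤ _ := by gcongr <;> exact M.one_le_majorant _ _ _

lemma act_le (j : ℤ) (n : ℕ) {f : X → ℝ≥0∞} (hf : Measurable f) {c : ℝ≥0∞}
    (hc : ∀ x, f x ≤ c) (x : X) : M.act y j n f x ≤ M.majorant y j n * c := by
  induction n generalizing j x with
  | zero => simpa [act_zero _ _ _ hf, majorant] using hc x
  | succ n ih =>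
    rw [act_succ _ _ _ _ hf, add_comm n 1, majorant_add, mul_assoc]
    refine mul_le_mul' ((M.g_le_supG x (y j)).trans (M.supG_le_majorant y j)) ?_
    calc ∫⁻ x', M.act y (j + 1) n f x' ∂M.Q x
        ≤ ∫⁻ _, M.majorant y (j + 1) n * c ∂M.Q x := lintegral_mono fun x' => ih _ x'
      _ = _ := by simp

lemma lkh_univ_le (j : ℤ) (n : ℕ) (x : X) :
    M.lkh (block y j n) x Set.univ ≤ M.majorant y j n := by
  rw [← act_one]
  simpa using M.act_le y j n measurable_const (fun _ => le_refl (1 : ℝ≥0∞)) x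

lemma supLkh_le_majorant (j : ℤ) (n : ℕ) : M.supLkh (block y j n) ≤ M.majorant y j n :=
  iSup_le fun x => M.lkh_univ_le y j n x

lemma push_univ_le (χ : ProbabilityMeasure X) (j : ℤ) (n : ℕ) :
    M.push χ (block y j n) Set.univ ≤ M.majorant y j n := by
  rw [push_apply _ _ _ MeasurableSet.univ]
  calc _ ≤ ∫⁻ _, M.majorant y j n ∂(χ : Measure X) :=
        lintegral_mono fun x => M.lkh_univ_le y j n x
    _ = _ := by simp

lemma act_pos (hg : ∀ x y, 0 < M.g x y) (j : ℤ) (n : ℕ) {f : X → ℝ≥0∞} (hf : Measurable f)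
    (hpos : ∀ x, 0 < f x) (x : X) : 0 < M.act y j n f x := by
  induction n generalizing j x with
  | zero => simpa only [act_zero _ _ _ hf] using hpos x
  | succ n ih =>
    rw [act_succ _ _ _ _ hf]
    exact ENNReal.mul_pos (by simpa using (hg x _).ne')
      (lintegral_pos_of_forall_pos (M.measurable_act _ _ _ hf) (ih _)).ne'

lemma wlik_pos (hg : ∀ x y, 0 < M.g x y) {μ : Measure X} (hμ : μ ≠ 0) (j : ℤ) (n : ℕ)
    {f : X → ℝ≥0∞} (hf : Measurable f) (hpos : ∀ x, 0 < f x) : 0 < M.wlik y μ j n f := by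
  have : NeZero μ := ⟨hμ⟩
  exact lintegral_pos_of_forall_pos (M.measurable_act y j n hf) (M.act_pos y hg j n hf hpos)

lemma wlik_ne_top {j : ℤ} {n : ℕ} (hy : M.majorant y j n ≠ ∞) (μ : Measure X)
    [IsFiniteMeasure μ] {f : X → ℝ≥0∞} (hf : Measurable f) {c : ℝ≥0∞} (hc : c ≠ ∞)
    (hfc : ∀ x, f x ≤ c) : M.wlik y μ j n f ≠ ∞ := by
  refine ((lintegral_mono fun x => M.act_le y j n hf hfc x).trans_lt ?_).ne
  rw [lintegral_const]
  finiteness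

lemma toReal_wlik_pos (hg : ∀ x y, 0 < M.g x y) {j : ℤ} {n : ℕ} (hy : M.majorant y j n ≠ ∞)
    {μ : Measure X} [IsFiniteMeasure μ] (hμ : μ ≠ 0) {f : X → ℝ≥0∞} (hf : Measurable f)
    (hpos : ∀ x, 0 < f x) {c : ℝ≥0∞} (hc : c ≠ ∞) (hfc : ∀ x, f x ≤ c) :
    0 < (M.wlik y μ j n f).toReal :=
  ENNReal.toReal_pos (M.wlik_pos y hg hμ j n hf hpos).ne' (M.wlik_ne_top y hy μ hf hc hfc)

lemma lik_pos (hg : ∀ x y, 0 < M.g x y) (χ : ProbabilityMeasure X) (j : ℤ) (n : ℕ) :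
    0 < M.lik χ (block y j n) := by
  rw [lik_eq_wlik]
  exact M.wlik_pos y hg (NeZero.ne _) j n measurable_const fun _ => one_pos

lemma lik_le_supLkh (χ : ProbabilityMeasure X) {n : ℕ} (z : Fin n → S) :
    M.lik χ z ≤ M.supLkh z := by
  rw [lik, push_apply _ _ _ MeasurableSet.univ]
  calc _ ≤ ∫⁻ _, M.supLkh z ∂(χ : Measure X) :=
        lintegral_mono fun x => le_iSup (fun x => M.lkh z x Set.univ) x
    _ = _ := by simp

end HMM

section Minorant

variable {Z : Type*} [MeasurableSpace Z]

/- Write `ν = n + m`. The gain comes from `n ≤ ρ • ν`, as `f` and `g` have the same integral against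
`m`. -/
lemma lintegral_le_add_of_minorant {ν m : Measure Z} [IsFiniteMeasure m] {κ ρ : ℝ≥0∞}
    (hρ : ρ + κ = 1) (hle : m ≤ ν) (hge : κ • ν ≤ m) {f g h : Z → ℝ≥0∞} (hg : Measurable g)
    (hfg : ∫⁻ z, f z ∂m = ∫⁻ z, g z ∂m) (hfgh : ∀ z, f z ≤ g z + h z) :
    ∫⁻ z, f z ∂ν ≤ ∫⁻ z, g z ∂ν + ρ * ∫⁻ z, h z ∂ν := by
  obtain ⟨n, hn⟩ : ∃ n, n + m = ν := ⟨ν - m, Measure.sub_add_cancel_of_le hle⟩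
  have hnρ : n ≤ ρ • ν := by
    refine Measure.le_iff.2 fun A _ => ?_
    have hsum : n A + m A ≤ (ρ • ν) A + m A := calc
      n A + m A = (ρ + κ) * ν A := by rw [hρ, one_mul, ← hn, Measure.add_apply]
      _ = (ρ • ν) A + (κ • ν) A := add_mul _ _ _
      _ ≤ (ρ • ν) A + m A := by gcongr
    exact (ENNReal.add_le_add_iff_right (measure_ne_top m A)).1 hsum
  have hsplit (f : Z → ℝ≥0∞) : ∫⁻ z, f z ∂ν = ∫⁻ z, f z ∂n + ∫⁻ z, f z ∂m := by
    rw [← hn, lintegral_add_measure]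
  calc ∫⁻ z, f z ∂ν = ∫⁻ z, f z ∂n + ∫⁻ z, g z ∂m := by rw [hsplit f, hfg]
    _ ≤ ∫⁻ z, (g z + h z) ∂n + ∫⁻ z, g z ∂m := by gcongr; exact hfgh _
    _ = ∫⁻ z, g z ∂ν + ∫⁻ z, h z ∂n := by rw [lintegral_add_left hg, hsplit g]; ring
    _ ≤ ∫⁻ z, g z ∂ν + ∫⁻ z, h z ∂(ρ • ν) := by gcongr
    _ = ∫⁻ z, g z ∂ν + ρ * ∫⁻ z, h z ∂ν := by rw [lintegral_smul_measure, smul_eq_mul]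

end Minorant

section CrossBound

variable {X : Type*}

/-- On the set `R` of pairs, the antisymmetric kernel `a(x) b(x') - b(x) a(x')` is at most
`ρ ^ (p - 2t)` times its symmetric counterpart, up to the error `η ^ t * s`, for every `t`. The
antisymmetric kernel is spread over both sides because the values are in `[0, ∞]`, and the truncated
exponent makes the bound void for `p ≤ 2t`. -/
def CrossBound (R : Set (X × X)) (ρ η s : ℝ≥0∞) (p : ℕ) (a b : X → ℝ≥0∞) : Prop :=
  ∀ t : ℕ, ∀ z ∈ R, a z.1 * b z.2 ≤ b z.1 * a z.2 +
    (ρ ^ (p - 2 * t) * (a z.1 * b z.2 + b z.1 * a z.2) + η ^ t * s)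

variable {a b : X → ℝ≥0∞} {C : Set X} {R : Set (X × X)} {c ρ η s σ : ℝ≥0∞} {p p' : ℕ}

lemma CrossBound.mono (h : CrossBound R ρ η s p a b) (hρ : ρ ≤ 1) (hp : p' ≤ p) :
    CrossBound R ρ η s p' a b := fun t z hz => by
  refine (h t z hz).trans ?_
  gcongr ?_ + (?_ * _ + _)
  · exact le_rfl
  · exact pow_le_pow_right_of_le_one' hρ (by omega)

lemma CrossBound.union {R' : Set (X × X)} (h : CrossBound R ρ η s p a b)
    (h' : CrossBound R' ρ η s p a b) : CrossBound (R ∪ R') ρ η s p a b :=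
  fun t z hz => hz.elim (h t z) (h' t z)

lemma le_add_pow_mul_add_of_eq_zero {q : ℕ} (hq : q = 0) (u v w : ℝ≥0∞) :
    u ≤ v + (ρ ^ q * (u + v) + w) := by
  rw [hq, pow_zero, one_mul]
  exact le_add_left (le_add_right le_self_add)

variable [MeasurableSpace X]

lemma lintegral_prod_cross_add (ha : Measurable a) (hb : Measurable b) (μ μ' : Measure X)
    [SFinite μ'] (θ H : ℝ≥0∞) :
    ∫⁻ z, (θ * (a z.1 * b z.2 + b z.1 * a z.2) + H) ∂(μ.prod μ') =
      θ * ((∫⁻ x, a x ∂μ) * (∫⁻ x, b x ∂μ') + (∫⁻ x, b x ∂μ) * ∫⁻ x, a x ∂μ') +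
        H * (μ Set.univ * μ' Set.univ) := by
  rw [lintegral_add_right _ measurable_const, lintegral_const_mul _ (by fun_prop),
    lintegral_add_left (by fun_prop), lintegral_prod_mul ha.aemeasurable hb.aemeasurable,
    lintegral_prod_mul hb.aemeasurable ha.aemeasurable, lintegral_const, ← Set.univ_prod_univ,
    Measure.prod_prod]

lemma lintegral_prod_restrict_le_of_comparable (ha : Measurable a) (hb : Measurable b)
    {μ μ' l : Measure X} [SFinite μ] [SFinite μ'] [IsFiniteMeasure l]
    (hρ : ρ + c * c = 1) {α α' : ℝ≥0} (hα : (α : ℝ≥0∞) • l ≤ μ.restrict C)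
    (hαc : c • μ.restrict C ≤ (α : ℝ≥0∞) • l) (hα' : (α' : ℝ≥0∞) • l ≤ μ'.restrict C)
    (hαc' : c • μ'.restrict C ≤ (α' : ℝ≥0∞) • l) {h : X × X → ℝ≥0∞}
    (hle : ∀ z, a z.1 * b z.2 ≤ b z.1 * a z.2 + h z) :
    ∫⁻ z in C ×ˢ C, a z.1 * b z.2 ∂(μ.prod μ') ≤
      ∫⁻ z in C ×ˢ C, b z.1 * a z.2 ∂(μ.prod μ') + ρ * ∫⁻ z in C ×ˢ C, h z ∂(μ.prod μ') := by
  rw [← Measure.prod_restrict]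
  have hfin (β : ℝ≥0) : IsFiniteMeasure ((β : ℝ≥0∞) • l) := l.smul_finite ENNReal.coe_ne_top
  have := hfin α
  have := hfin α'
  refine lintegral_le_add_of_minorant (m := ((α : ℝ≥0∞) • l).prod ((α' : ℝ≥0∞) • l)) hρ
    (Measure.prod_mono hα hα') ?_ (by fun_prop) ?_ hle
  · calc (c * c) • (μ.restrict C).prod (μ'.restrict C)
        = (c • μ.restrict C).prod (c • μ'.restrict C) := by
          rw [Measure.prod_smul_left, Measure.prod_smul_right, smul_smul]
      _ ≤ _ := Measure.prod_mono hαc hαc'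
  · rw [lintegral_prod_mul ha.aemeasurable hb.aemeasurable,
      lintegral_prod_mul hb.aemeasurable ha.aemeasurable]
    simp only [lintegral_smul_measure, smul_eq_mul]
    ring

lemma lintegral_mul_le_of_comparable (ha : Measurable a) (hb : Measurable b) {μ μ' l : Measure X}
    [SFinite μ] [SFinite μ'] [IsFiniteMeasure l] (hC : MeasurableSet C) (hρ : ρ + c * c = 1)
    {α α' : ℝ≥0} (hα : (α : ℝ≥0∞) • l ≤ μ.restrict C)
    (hαc : c • μ.restrict C ≤ (α : ℝ≥0∞) • l) (hα' : (α' : ℝ≥0∞) • l ≤ μ'.restrict C)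
    (hαc' : c • μ'.restrict C ≤ (α' : ℝ≥0∞) • l) {θ H : ℝ≥0∞}
    (hle : ∀ z : X × X, a z.1 * b z.2 ≤
      b z.1 * a z.2 + (θ * (a z.1 * b z.2 + b z.1 * a z.2) + H))
    (hoff : ∀ z ∈ (C ×ˢ C)ᶜ, a z.1 * b z.2 ≤
      b z.1 * a z.2 + (ρ * θ * (a z.1 * b z.2 + b z.1 * a z.2) + H)) :
    ∫⁻ z, a z.1 * b z.2 ∂(μ.prod μ') ≤ ∫⁻ z, b z.1 * a z.2 ∂(μ.prod μ') +
      ∫⁻ z, (ρ * θ * (a z.1 * b z.2 + b z.1 * a z.2) + H) ∂(μ.prod μ') := by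
  have hCC : MeasurableSet (C ×ˢ C) := hC.prod hC
  have hon : ∫⁻ z in C ×ˢ C, a z.1 * b z.2 ∂(μ.prod μ') ≤ ∫⁻ z in C ×ˢ C, (b z.1 * a z.2 +
      (ρ * θ * (a z.1 * b z.2 + b z.1 * a z.2) + H)) ∂(μ.prod μ') := by
    refine (lintegral_prod_restrict_le_of_comparable ha hb hρ hα hαc hα' hαc' hle).trans ?_
    rw [← lintegral_const_mul _ (by fun_prop), ← lintegral_add_left (by fun_prop)]
    refine lintegral_mono fun z => ?_
    rw [mul_add, mul_assoc]
    gcongr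
    exact mul_le_of_le_one_left' (hρ ▸ le_self_add)
  rw [← lintegral_add_left (by fun_prop), ← lintegral_add_compl _ hCC,
    ← lintegral_add_compl (fun z : X × X => b z.1 * a z.2 + _) hCC]
  exact add_le_add hon (setLIntegral_mono (by fun_prop) hoff)

/-- The functions `a` and `b` satisfy the cross bound with exponent `p` at all pairs, and
`a(x) b(x')` is at most `s`. -/
structure Mixes (ρ η s : ℝ≥0∞) (p : ℕ) (a b : X → ℝ≥0∞) : Prop where
  measurable_left : Measurable a
  measurable_right : Measurable b
  mul_le : ∀ x x', a x * b x' ≤ s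
  crossBound : CrossBound Set.univ ρ η s p a b

/-- `Mixes` with exponent `p`, and with exponent `p + 1` at the pairs outside `C × C`. -/
structure MixesOff (C : Set X) (ρ η s : ℝ≥0∞) (p : ℕ) (a b : X → ℝ≥0∞) : Prop
    extends Mixes ρ η s p a b where
  crossBound_off : CrossBound (C ×ˢ C)ᶜ ρ η s (p + 1) a b

/-- The kernel `L` satisfies a Doeblin condition on `C`, with ratio `c`, and has mass at most `η σ`
off `C`. -/
structure DoeblinOn (C : Set X) (c η σ : ℝ≥0∞) (L : Kernel X X) : Prop where
  comparable : ∃ l : Measure X, IsFiniteMeasure l ∧ ∀ x ∈ C, ∃ α : ℝ≥0,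
    (α : ℝ≥0∞) • l ≤ (L x).restrict C ∧ c • (L x).restrict C ≤ (α : ℝ≥0∞) • l
  off : ∀ x ∉ C, L x Set.univ ≤ η * σ

lemma Mixes.mono (h : Mixes ρ η s p a b) (hρ : ρ ≤ 1) (hp : p' ≤ p) : Mixes ρ η s p' a b :=
  { h with crossBound := h.crossBound.mono hρ hp }

lemma MixesOff.mono (h : MixesOff C ρ η s p a b) (hρ : ρ ≤ 1) (hp : p' ≤ p) :
    MixesOff C ρ η s p' a b :=
  { h.toMixes.mono hρ hp with crossBound_off := h.crossBound_off.mono hρ (by omega) }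

lemma Mixes.of_mul_le (ha : Measurable a) (hb : Measurable b) (hs : ∀ x x', a x * b x' ≤ s) :
    Mixes ρ η s 0 a b where
  measurable_left := ha
  measurable_right := hb
  mul_le := hs
  crossBound _ _ _ := le_add_pow_mul_add_of_eq_zero (Nat.zero_sub _) _ _ _

lemma Mixes.lintegral_le (h : Mixes ρ η s p a b) (μ μ' : Measure X) [SFinite μ'] (t : ℕ) :
    (∫⁻ x, a x ∂μ) * ∫⁻ x, b x ∂μ' ≤ (∫⁻ x, b x ∂μ) * (∫⁻ x, a x ∂μ') +
      (ρ ^ (p - 2 * t) * ((∫⁻ x, a x ∂μ) * (∫⁻ x, b x ∂μ') + (∫⁻ x, b x ∂μ) * ∫⁻ x, a x ∂μ') +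
        η ^ t * s * (μ Set.univ * μ' Set.univ)) := by
  have ha := h.measurable_left
  have hb := h.measurable_right
  rw [← lintegral_prod_cross_add ha hb, ← lintegral_prod_mul ha.aemeasurable hb.aemeasurable,
    ← lintegral_prod_mul hb.aemeasurable ha.aemeasurable, ← lintegral_add_left (by fun_prop)]
  exact lintegral_mono fun z => h.crossBound t z trivial

lemma Mixes.lintegral_mul_le (h : Mixes ρ η s p a b) (μ μ' : Measure X) [SFinite μ'] :
    (∫⁻ x, a x ∂μ) * ∫⁻ x, b x ∂μ' ≤ s * (μ Set.univ * μ' Set.univ) := by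
  rw [← lintegral_prod_mul h.measurable_left.aemeasurable h.measurable_right.aemeasurable,
    ← Measure.prod_prod, Set.univ_prod_univ, ← lintegral_const]
  exact lintegral_mono fun z => h.mul_le z.1 z.2

section Kernel

variable {L : Kernel X X}

lemma mul_mul_mul_mul_le {u v : ℝ≥0∞} (hu : u ≤ σ) (hv : v ≤ σ) (w : ℝ≥0∞) :
    w * s * (u * v) ≤ w * (σ * σ * s) := by
  rw [mul_assoc, mul_comm s]
  gcongr

lemma Mixes.lintegral_kernel (h : Mixes ρ η s p a b) (hσ : σ ≠ ∞) (hL : ∀ x, L x Set.univ ≤ σ) :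
    Mixes ρ η (σ * σ * s) p (fun x => ∫⁻ x', a x' ∂L x) (fun x => ∫⁻ x', b x' ∂L x) := by
  have hfin (x : X) : IsFiniteMeasure (L x) := ⟨(hL x).trans_lt hσ.lt_top⟩
  refine ⟨h.measurable_left.lintegral_kernel, h.measurable_right.lintegral_kernel,
    fun x x' => ?_, fun t z _ => ?_⟩
  · rw [mul_comm _ s]
    exact (h.lintegral_mul_le _ _).trans (by gcongr <;> exact hL _)
  · refine (h.lintegral_le (L z.1) (L z.2) t).trans ?_
    gcongr _ + (_ + ?_)
    exact mul_mul_mul_mul_le (hL z.1) (hL z.2) _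

/- A visit off `C` costs a factor `η`, which pays for two more powers of `ρ`. -/
lemma Mixes.crossBound_off_of_doeblinOn (h : Mixes ρ η s p a b) (hσ : σ ≠ ∞)
    (hL : ∀ x, L x Set.univ ≤ σ) (hD : DoeblinOn C c η σ L) :
    CrossBound (C ×ˢ C)ᶜ ρ η (σ * σ * s) (p + 2) (fun x => ∫⁻ x', a x' ∂L x)
      (fun x => ∫⁻ x', b x' ∂L x) := by
  have hfin (x : X) : IsFiniteMeasure (L x) := ⟨(hL x).trans_lt hσ.lt_top⟩
  rintro (_ | t) ⟨x, x'⟩ hx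
  · rw [pow_zero, one_mul]
    exact ((h.lintegral_kernel hσ hL).mul_le x x').trans (le_add_left le_add_self)
  have hmass : L x Set.univ * L x' Set.univ ≤ η * (σ * σ) := by
    by_cases hxC : x ∈ C
    · calc L x Set.univ * L x' Set.univ ≤ σ * (η * σ) :=
            mul_le_mul' (hL x) (hD.off x' fun hx'C => hx ⟨hxC, hx'C⟩)
        _ = η * (σ * σ) := by ring
    · exact (mul_le_mul' (hD.off x hxC) (hL x')).trans_eq (mul_assoc _ _ _)
  refine (h.lintegral_le (L x) (L x') t).trans ?_
  rw [show p + 2 - 2 * (t + 1) = p - 2 * t by omega]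
  gcongr _ + (_ + ?_)
  calc η ^ t * s * (L x Set.univ * L x' Set.univ) ≤ η ^ t * s * (η * (σ * σ)) := by gcongr
    _ = η ^ (t + 1) * (σ * σ * s) := by ring

lemma Mixes.mixesOff_lintegral_kernel (h : Mixes ρ η s p a b) (hρ : ρ ≤ 1) (hσ : σ ≠ ∞)
    (hL : ∀ x, L x Set.univ ≤ σ) (hD : DoeblinOn C c η σ L) :
    MixesOff C ρ η (σ * σ * s) p (fun x => ∫⁻ x', a x' ∂L x) (fun x => ∫⁻ x', b x' ∂L x) :=
  { h.lintegral_kernel hσ hL with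
    crossBound_off := (h.crossBound_off_of_doeblinOn hσ hL hD).mono hρ (by omega) }

/- From `C × C`, either the next pair is again in `C × C`, where the Doeblin condition contracts by
the factor `ρ`, or it leaves `C × C`, where the bound is already better by the factor `ρ`. -/
lemma MixesOff.crossBound_of_doeblinOn (h : MixesOff C ρ η s p a b) (hC : MeasurableSet C)
    (hρ : ρ + c * c = 1) (hσ : σ ≠ ∞) (hL : ∀ x, L x Set.univ ≤ σ) (hD : DoeblinOn C c η σ L) :
    CrossBound (C ×ˢ C) ρ η (σ * σ * s) (p + 1) (fun x => ∫⁻ x', a x' ∂L x)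
      (fun x => ∫⁻ x', b x' ∂L x) := by
  have hfin (x : X) : IsFiniteMeasure (L x) := ⟨(hL x).trans_lt hσ.lt_top⟩
  rintro t ⟨x, x'⟩ ⟨hx, hx'⟩
  obtain htp | htp := lt_or_ge p (2 * t)
  · exact le_add_pow_mul_add_of_eq_zero (by omega) _ _ _
  obtain ⟨l, _, hcomp⟩ := hD.comparable
  obtain ⟨α, hα, hαc⟩ := hcomp x hx
  obtain ⟨α', hα', hαc'⟩ := hcomp x' hx'
  have ha := h.measurable_left
  have hb := h.measurable_right
  have hpow : ρ ^ (p + 1 - 2 * t) = ρ * ρ ^ (p - 2 * t) := by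
    rw [← pow_succ', show p + 1 - 2 * t = p - 2 * t + 1 by omega]
  have hcontr := lintegral_mul_le_of_comparable ha hb hC hρ hα hαc hα' hαc'
    (fun z => h.crossBound t z trivial) (by simpa only [hpow] using h.crossBound_off t)
  rw [lintegral_prod_cross_add ha hb, lintegral_prod_mul ha.aemeasurable hb.aemeasurable,
    lintegral_prod_mul hb.aemeasurable ha.aemeasurable, ← hpow] at hcontr
  refine hcontr.trans ?_
  gcongr _ + (_ + ?_)
  exact mul_mul_mul_mul_le (hL x) (hL x') _

lemma MixesOff.lintegral_kernel (h : MixesOff C ρ η s p a b) (hC : MeasurableSet C)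
    (hρ : ρ + c * c = 1) (hσ : σ ≠ ∞) (hL : ∀ x, L x Set.univ ≤ σ) (hD : DoeblinOn C c η σ L) :
    MixesOff C ρ η (σ * σ * s) (p + 1) (fun x => ∫⁻ x', a x' ∂L x)
      (fun x => ∫⁻ x', b x' ∂L x) := by
  have hon := h.crossBound_of_doeblinOn hC hρ hσ hL hD
  have hoff := h.crossBound_off_of_doeblinOn hσ hL hD
  have hall := hon.union (hoff.mono (hρ ▸ le_self_add) p.succ.le_succ)
  rw [Set.union_compl_self] at hall
  exact { h.toMixes.lintegral_kernel hσ hL with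
    crossBound := hall
    crossBound_off := hoff }

end Kernel

end CrossBound

/-- The number of indices `0 ≤ l < N` for which the block `y_{(i+l)r}, …, y_{(i+l+1)r-1}` is not
in `K`. -/
noncomputable def badCount {E : Type*} {r : ℕ} (K : Set (Fin r → E)) (y : ℤ → E) (i : ℤ)
    (N : ℕ) : ℕ :=
  ∑ l ∈ Finset.range N, Kᶜ.indicator 1 (block y ((i + l) * r) r)

lemma badCount_succ {E : Type*} {r : ℕ} (K : Set (Fin r → E)) (y : ℤ → E) (i : ℤ) (N : ℕ) :
    badCount K y i (N + 1) = badCount K y (i + 1) N + Kᶜ.indicator 1 (block y (i * r) r) := by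
  rw [badCount, Finset.sum_range_succ', badCount, Nat.cast_zero, add_zero]
  congr! 5 with l
  push_cast
  ring

namespace HMM

variable {X S : Type*} [MeasurableSpace X] [MeasurableSpace S] {M : HMM X S} {r : ℕ}
  {C : Set X} {εm εp : (Fin r → S) → ℝ≥0} {lam : (Fin r → S) → ProbabilityMeasure X}
  {φ : (Fin r → S) → X → ℝ≥0} {c η : ℝ≥0∞}

lemma IsLocalDoeblin.doeblinOn (h : M.IsLocalDoeblin r C εm εp lam φ) {z : Fin r → S}
    (hc : c ≤ (εm z : ℝ≥0∞) / εp z) {σ : ℝ≥0∞} (hσ : M.supLkh z ≤ σ)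
    (hη : (⨆ x ∈ Cᶜ, M.lkh z x Set.univ) ≤ η * M.supLkh z) : DoeblinOn C c η σ (M.lkh z) where
  comparable := by
    refine ⟨lam z, inferInstance, fun x hx => ⟨εm z * φ z x, ?_, ?_⟩⟩ <;>
      refine Measure.le_iff.2 fun A hA => ?_ <;>
      simp only [Measure.smul_apply, Measure.restrict_apply hA, smul_eq_mul, ENNReal.coe_mul]
    · exact h.lower z x hx A hA
    · have hεp : (εp z : ℝ≥0∞) ≠ 0 := by simpa using (h.εp_pos z).ne'
      have hcε : c * εp z ≤ εm z :=
        (ENNReal.le_div_iff_mul_le (Or.inl hεp) (Or.inl ENNReal.coe_ne_top)).1 hc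
      calc c * M.lkh z x (A ∩ C) ≤ c * (εp z * φ z x * (lam z : Measure X) A) := by
            gcongr; exact h.upper z x hx A hA
        _ = c * εp z * (φ z x * (lam z : Measure X) A) := by ring
        _ ≤ εm z * (φ z x * (lam z : Measure X) A) := by gcongr
        _ = _ := by ring
  off x hx := calc
    M.lkh z x Set.univ ≤ ⨆ x ∈ Cᶜ, M.lkh z x Set.univ :=
      le_iSup₂ (f := fun x (_ : x ∈ Cᶜ) => M.lkh z x Set.univ) x hx
    _ ≤ η * M.supLkh z := hη
    _ ≤ η * σ := by gcongr

variable {y : ℤ → S} {ρ s : ℝ≥0∞} {a b : X → ℝ≥0∞}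

lemma mixes_act {p : ℕ} (h : Mixes ρ η s p a b) {j : ℤ} {n : ℕ} (hy : M.majorant y j n ≠ ∞) :
    Mixes ρ η (M.majorant y j n * M.majorant y j n * s) p (M.act y j n a) (M.act y j n b) :=
  h.lintegral_kernel hy (M.lkh_univ_le y j n)

/-- The kernels `L⟨z⟩`, `z ∈ K`, satisfy the Doeblin condition on a common `r`-local Doeblin set,
with mass at most `η ‖L⟨z⟩ 1‖_∞` off it, and contract by the factor `ρ` on it. -/
structure IsMixing (M : HMM X S) (r : ℕ) (K : Set (Fin r → S)) (ρ η : ℝ≥0∞) : Prop where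
  pos : 0 < ρ
  lt_one : ρ < 1
  exists_isLocalDoeblin : ∃ C εm εp lam φ, ∃ c : ℝ≥0∞, M.IsLocalDoeblin r C εm εp lam φ ∧
    (∀ z ∈ K, c ≤ (εm z : ℝ≥0∞) / εp z) ∧
    (∀ z ∈ K, (⨆ x ∈ Cᶜ, M.lkh z x Set.univ) ≤ η * M.supLkh z) ∧ ρ + c * c = 1

variable {K : Set (Fin r → S)}

/- A bad block leaves the exponent unchanged but destroys its improvement off `C × C`, which the
next good block only restores: hence the factor `2`. -/
lemma mixes_or_mixesOff_blocks (hC : MeasurableSet C) (hρ : ρ + c * c = 1)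
    (hK : ∀ i : ℤ, block y (i * r) r ∈ K →
      DoeblinOn C c η (M.majorant y (i * r) r) (M.lkh (block y (i * r) r)))
    (hy : ∀ j n, M.majorant y j n ≠ ∞) (hab : Mixes ρ η s 0 a b) (N : ℕ) (i : ℤ) :
    Mixes ρ η (M.majorant y (i * r) (N * r) * M.majorant y (i * r) (N * r) * s)
        (N - 2 * badCount K y i N) (M.act y (i * r) (N * r) a) (M.act y (i * r) (N * r) b) ∨
      MixesOff C ρ η (M.majorant y (i * r) (N * r) * M.majorant y (i * r) (N * r) * s)
        (N - (2 * badCount K y i N + 1)) (M.act y (i * r) (N * r) a)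
        (M.act y (i * r) (N * r) b) := by
  have hρ1 : ρ ≤ 1 := hρ ▸ le_self_add
  have ha := hab.measurable_left
  have hb := hab.measurable_right
  induction N generalizing i with
  | zero =>
    rw [zero_mul, act_zero _ _ _ ha, act_zero _ _ _ hb]
    exact Or.inl (by simpa [majorant] using hab)
  | succ N ih =>
    set σ := M.majorant y (i * r) r
    have hσ : σ ≠ ∞ := hy _ _
    have hL := M.lkh_univ_le y (i * r) r
    have hs (u : ℝ≥0∞) : σ * u * (σ * u) * s = σ * σ * (u * u * s) := by ring
    have hi : (i + 1) * (r : ℤ) = i * r + r := by ring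
    have ih := ih (i + 1)
    rw [hi] at ih
    rw [add_one_mul, add_comm (N * r), act_add _ _ _ _ _ ha, act_add _ _ _ _ _ hb, majorant_add,
      hs, badCount_succ]
    by_cases hiK : block y (i * r) r ∈ K
    · rw [Set.indicator_of_notMem (not_not_intro hiK)]
      refine Or.inr ?_
      obtain h | h := ih
      · exact (h.mixesOff_lintegral_kernel hρ1 hσ hL (hK i hiK)).mono hρ1 (by omega)
      · exact (h.lintegral_kernel hC hρ hσ hL (hK i hiK)).mono hρ1 (by omega)
    · rw [Set.indicator_of_mem hiK, Pi.one_apply]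
      refine Or.inl ?_
      obtain h | h := ih
      · exact (mixes_act h hσ).mono hρ1 (by omega)
      · exact (mixes_act h.toMixes hσ).mono hρ1 (by omega)

/- The window `[-(l + p r), q r + e)` consists of `p + q` blocks, preceded by `l` and followed by
`e` further times. -/
lemma mixes_act_window (hC : MeasurableSet C) (hρ : ρ + c * c = 1)
    (hK : ∀ i : ℤ, block y (i * r) r ∈ K →
      DoeblinOn C c η (M.majorant y (i * r) r) (M.lkh (block y (i * r) r)))
    (hy : ∀ j n, M.majorant y j n ≠ ∞) (hab : Mixes ρ η s 0 a b) (l p q e : ℕ) :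
    Mixes ρ η (M.majorant y (-(l + p * r : ℕ)) (l + p * r + (q * r + e)) *
        M.majorant y (-(l + p * r : ℕ)) (l + p * r + (q * r + e)) * s)
      (p + q - (2 * badCount K y (-p) (p + q) + 1))
      (M.act y (-(l + p * r : ℕ)) (l + p * r + (q * r + e)) a)
      (M.act y (-(l + p * r : ℕ)) (l + p * r + (q * r + e)) b) := by
  have hblocks : Mixes ρ η _ (p + q - (2 * badCount K y (-p) (p + q) + 1)) _ _ :=
    (mixes_or_mixesOff_blocks hC hρ hK hy (mixes_act hab (hy (q * r) e)) (p + q) (-p)).elim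
      (fun h => h.mono (hρ ▸ le_self_add) (by omega)) MixesOff.toMixes
  have hlen : l + p * r + (q * r + e) = l + ((p + q) * r + e) := by ring
  have hj : -((l + p * r : ℕ) : ℤ) + l = -p * r := by push_cast; ring
  have hj' : -(p : ℤ) * r + ((p + q) * r : ℕ) = q * r := by push_cast; ring
  have ha := hab.measurable_left
  have hb := hab.measurable_right
  rw [hlen, act_add _ _ _ _ _ ha, act_add _ _ _ _ _ hb, act_add _ _ _ _ _ ha,
    act_add _ _ _ _ _ hb, majorant_add, majorant_add, hj, hj']
  convert mixes_act hblocks (hy (-(l + p * r : ℕ)) l) using 1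
  ring

theorem IsMixing.mixes_act (h : M.IsMixing r K ρ η) (hy : ∀ j n, M.majorant y j n ≠ ∞)
    (hab : Mixes ρ η s 0 a b) (m k : ℕ) :
    Mixes ρ η (M.majorant y (-m) (m + k) * M.majorant y (-m) (m + k) * s)
      (m / r + k / r - (2 * badCount K y (-(m / r : ℕ)) (m / r + k / r) + 1))
      (M.act y (-m) (m + k) a) (M.act y (-m) (m + k) b) := by
  obtain ⟨C, εm, εp, lam, φ, c, hC, hc, hη, hρ⟩ := h.exists_isLocalDoeblin
  have hK (i : ℤ) (hi : block y (i * r) r ∈ K) :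
      DoeblinOn C c η (M.majorant y (i * r) r) (M.lkh (block y (i * r) r)) :=
    hC.doeblinOn (hc _ hi) (M.supLkh_le_majorant y _ _) (hη _ hi)
  have h := mixes_act_window hC.measurableSet hρ hK hy hab (m % r) (m / r) (k / r) (k % r)
  rwa [Nat.mod_add_div', Nat.div_add_mod'] at h

end HMM

/-- The exponential of a real number, as an element of `[0, ∞]`. -/
noncomputable def expE (x : ℝ) : ℝ≥0∞ := ENNReal.ofReal (Real.exp x)

lemma expE_add (x y : ℝ) : expE (x + y) = expE x * expE y := by
  rw [expE, Real.exp_add, ENNReal.ofReal_mul (Real.exp_pos x).le]; rfl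

lemma expE_mono {x y : ℝ} (h : x ≤ y) : expE x ≤ expE y :=
  ENNReal.ofReal_le_ofReal (Real.exp_le_exp.2 h)

lemma expE_ne_top (x : ℝ) : expE x ≠ ∞ := ENNReal.ofReal_ne_top

lemma expE_pos (x : ℝ) : 0 < expE x := ENNReal.ofReal_pos.2 (Real.exp_pos x)

lemma expE_zero : expE 0 = 1 := by rw [expE, Real.exp_zero, ENNReal.ofReal_one]

lemma toReal_expE (x : ℝ) : (expE x).toReal = Real.exp x :=
  ENNReal.toReal_ofReal (Real.exp_pos x).le

lemma expE_sum {ι : Type*} (s : Finset ι) (f : ι → ℝ) :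
    expE (∑ i ∈ s, f i) = ∏ i ∈ s, expE (f i) := by
  rw [expE, Real.exp_sum, ENNReal.ofReal_prod_of_nonneg fun i _ => (Real.exp_pos _).le]; rfl

lemma expE_pow (x : ℝ) (n : ℕ) : expE x ^ n = expE (n * x) := by
  rw [expE, expE, ← ENNReal.ofReal_pow (Real.exp_pos x).le, ← Real.exp_nat_mul]

lemma expE_sub_le_of_expE_le_mul {x y : ℝ} {a b : ℝ≥0∞} (h : expE x ≤ a * b)
    (hb : b ≤ expE y) : expE (x - y) ≤ a := by
  have h1 : expE (x - y) * expE y ≤ a * expE y := by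
    rw [← expE_add, sub_add_cancel]
    exact h.trans (by gcongr)
  exact (ENNReal.mul_le_mul_iff_left (expE_pos y).ne' (expE_ne_top y)).1 h1

lemma le_coe_of_toENNReal_le_ofReal {a : EReal} {x : ℝ} (hx : 0 ≤ x)
    (h : a.toENNReal ≤ ENNReal.ofReal x) : a ≤ x :=
  calc a ≤ a.toENNReal := EReal.coe_toENNReal_eq_max ▸ le_max_right _ _
    _ ≤ ENNReal.ofReal x := EReal.coe_ennreal_le_coe_ennreal_iff.2 h
    _ = x := by rw [EReal.coe_ennreal_ofReal, max_eq_left hx]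

lemma expE_neg_le_of_logMinus_le {x : ℝ} (hx : 0 ≤ x) {a : ℝ≥0∞}
    (h : logMinus a ≤ ENNReal.ofReal x) : expE (-x) ≤ a := by
  have hlog : ((-x : ℝ) : EReal) ≤ ENNReal.log a :=
    EReal.neg_le.1 (le_coe_of_toENNReal_le_ofReal hx h)
  exact (EReal.exp_monotone hlog).trans_eq (ENNReal.exp_log a)

lemma expE_neg_logMinus_le {a : ℝ≥0∞} (h : logMinus a < ∞) :
    expE (-(logMinus a).toReal) ≤ a :=
  expE_neg_le_of_logMinus_le ENNReal.toReal_nonneg (ENNReal.ofReal_toReal h.ne).ge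

lemma le_expE_logPlus {a : ℝ≥0∞} (h : logPlus a < ∞) : a ≤ expE (logPlus a).toReal :=
  have hlog : ENNReal.log a ≤ ((logPlus a).toReal : ℝ) :=
    le_coe_of_toENNReal_le_ofReal ENNReal.toReal_nonneg (ENNReal.ofReal_toReal h.ne).ge
  (ENNReal.exp_log a).symm.trans_le (EReal.exp_monotone hlog)

lemma measurable_logMinus : Measurable logMinus :=
  ENNReal.measurable_log.neg.ereal_toENNReal

namespace HMM

variable {X S : Type*} [MeasurableSpace X] [MeasurableSpace S] (M : HMM X S)

/-- The product of the numbers `inf_{x ∈ D} L⟨Z_l⟩(x, D)` over the blocks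
`Z_l = (y_{lr}, …, y_{lr+r-1})`, `i ≤ l < i + N`: a lower bound for the mass that stays in `D`. -/
noncomputable def prodInf (r : ℕ) (D : Set X) (y : ℤ → S) (i : ℤ) (N : ℕ) : ℝ≥0∞ :=
  ∏ l ∈ Finset.range N, ⨅ x ∈ D, M.lkh (block y ((i + l) * r) r) x D

variable {r : ℕ} {D : Set X} (y : ℤ → S)

lemma prodInf_succ (i : ℤ) (N : ℕ) :
    M.prodInf r D y i (N + 1) =
      M.prodInf r D y (i + 1) N * ⨅ x ∈ D, M.lkh (block y (i * r) r) x D := by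
  rw [prodInf, Finset.prod_range_succ', Nat.cast_zero, add_zero]
  congr 1
  refine Finset.prod_congr rfl fun l _ => ?_
  rw [Nat.cast_succ, show i + ((l : ℤ) + 1) = i + 1 + l by ring]

lemma prodInf_le_lkh (hD : MeasurableSet D) (i : ℤ) (N : ℕ) {x : X} (hx : x ∈ D) :
    M.prodInf r D y i N ≤ M.lkh (block y (i * r) (N * r)) x D := by
  rw [← act_indicator _ _ _ _ hD]
  have hm : Measurable (D.indicator (1 : X → ℝ≥0∞)) := measurable_one.indicator hD
  induction N generalizing i x with
  | zero => simp [act_zero _ _ _ hm, prodInf, hx]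
  | succ N ih =>
    calc M.prodInf r D y i (N + 1)
        ≤ M.prodInf r D y (i + 1) N * M.lkh (block y (i * r) r) x D := by
          rw [prodInf_succ]; gcongr; exact iInf₂_le x hx
      _ = M.act y (i * r) r (fun x => M.prodInf r D y (i + 1) N * D.indicator 1 x) x := by
          rw [act_const_mul _ _ _ _ _ hm, act_indicator _ _ _ _ hD]
      _ ≤ M.act y (i * r) r (M.act y ((i + 1) * r) (N * r) (D.indicator 1)) x :=
          act_mono _ _ _ _ (fun x' => by
            by_cases hx' : x' ∈ D
            · simpa [hx'] using ih (i + 1) hx'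
            · simp [hx']) x
      _ = M.act y (i * r) ((N + 1) * r) (D.indicator 1) x := by
          rw [add_one_mul N r, add_comm _ r, act_add _ _ _ _ _ hm, add_one_mul i]

lemma push_mul_prodInf_le_lik (hD : MeasurableSet D) (χ : ProbabilityMeasure X) {i j : ℤ}
    {l : ℕ} (h : j + l = i * r) (N : ℕ) :
    M.push χ (block y j l) D * M.prodInf r D y i N ≤ M.lik χ (block y j (l + N * r)) := by
  rw [lik_add, h]
  calc M.push χ (block y j l) D * M.prodInf r D y i N
      = ∫⁻ _ in D, M.prodInf r D y i N ∂M.push χ (block y j l) := by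
        rw [setLIntegral_const, mul_comm]
    _ ≤ ∫⁻ x in D, M.act y (i * r) (N * r) (fun _ => 1) x ∂M.push χ (block y j l) := by
        refine setLIntegral_mono (M.measurable_act _ _ _ measurable_const) fun x hx => ?_
        rw [act_one]
        exact (M.prodInf_le_lkh y hD i N hx).trans (measure_mono (Set.subset_univ _))
    _ ≤ M.wlik y (M.push χ (block y j l)) (i * r) (N * r) fun _ => 1 :=
        setLIntegral_le_lintegral _ _

lemma prodInf_le_supLkh (hD : MeasurableSet D) (hne : D.Nonempty) (i : ℤ) (N : ℕ) :
    M.prodInf r D y i N ≤ M.supLkh (block y (i * r) (N * r)) := by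
  obtain ⟨x, hx⟩ := hne
  exact ((M.prodInf_le_lkh y hD i N hx).trans (measure_mono (Set.subset_univ _))).trans
    (le_iSup (fun x => M.lkh (block y (i * r) (N * r)) x Set.univ) x)

lemma lik_add_le (χ : ProbabilityMeasure X) (j : ℤ) (n e : ℕ) :
    M.lik χ (block y j (n + e)) ≤ M.lik χ (block y j n) * M.majorant y (j + n) e := by
  rw [lik_add]
  calc _ ≤ ∫⁻ _, M.majorant y (j + n) e ∂M.push χ (block y j n) :=
        lintegral_mono fun x => by rw [act_one]; exact M.lkh_univ_le y _ _ x
    _ = M.lik χ (block y j n) * M.majorant y (j + n) e := by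
        rw [lintegral_const, mul_comm]; rfl

lemma supLkh_add_le (j : ℤ) (l n : ℕ) :
    M.supLkh (block y j (l + n)) ≤ M.supLkh (block y (j + l) n) * M.majorant y j l := by
  refine iSup_le fun x => ?_
  rw [← act_one, act_add _ _ _ _ _ measurable_const, mul_comm]
  refine M.act_le y j l (M.measurable_act _ _ _ measurable_const) (fun x' => ?_) x
  rw [act_one]
  exact le_iSup (fun x => M.lkh (block y (j + l) n) x Set.univ) x'

/- The window `[-m, k)` is completed to the right to a union of aligned blocks, after an initial
piece of length `m % r`. -/
lemma push_mul_prodInf_le_lik_mul_majorant (hD : MeasurableSet D) (hr : 0 < r)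
    (χ : ProbabilityMeasure X) (m k : ℕ) :
    M.push χ (block y (-m) (m % r)) D * M.prodInf r D y (-(m / r : ℕ)) (m / r + (k / r + 1)) ≤
      M.lik χ (block y (-m) (m + k)) * M.majorant y (-m) (m + (k + r)) := by
  have hm := Nat.mod_add_div' m r
  have hk := Nat.mod_add_div' k r
  have hkr := Nat.mod_lt k hr
  have hstart : -(m : ℤ) + (m % r : ℕ) = -(m / r : ℕ) * r := by
    have : ((m % r : ℕ) : ℤ) + (m / r : ℕ) * r = m := by exact_mod_cast hm
    linarith
  have hlen : m % r + (m / r + (k / r + 1)) * r = (m + k) + (r - k % r) := by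
    have : (m / r + (k / r + 1)) * r = m / r * r + (k / r * r + r) := by ring
    omega
  calc _ ≤ M.lik χ (block y (-m) ((m + k) + (r - k % r))) :=
        hlen ▸ M.push_mul_prodInf_le_lik y hD χ hstart _
    _ ≤ M.lik χ (block y (-m) (m + k)) * M.majorant y (-m + (m + k : ℕ)) (r - k % r) :=
        M.lik_add_le y χ _ _ _
    _ ≤ _ := by
        gcongr
        exact M.majorant_le_of_le y (by omega) (by omega)

lemma prodInf_le_supLkh_mul_majorant (hD : MeasurableSet D) (hne : D.Nonempty) (hr : 0 < r)
    (m : ℕ) :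
    M.prodInf r D y (-(m / r + 1 : ℕ)) (m / r + 1) ≤
      M.supLkh (block y (-m) m) * M.majorant y (-(m + r : ℕ)) (m + r) := by
  have hlen : (m / r + 1) * r = (r - m % r) + m := by
    have := Nat.mod_add_div' m r
    have := Nat.mod_lt m hr
    rw [add_one_mul]
    omega
  have hstart : -((m / r + 1 : ℕ) : ℤ) * r + (r - m % r : ℕ) = -m := by
    have : ((m / r + 1 : ℕ) : ℤ) * r = (r - m % r : ℕ) + m := by exact_mod_cast hlen
    linarith
  calc M.prodInf r D y (-(m / r + 1 : ℕ)) (m / r + 1)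
      ≤ M.supLkh (block y (-(m / r + 1 : ℕ) * r) ((r - m % r) + m)) :=
        hlen ▸ M.prodInf_le_supLkh y hD hne _ _
    _ ≤ M.supLkh (block y (-m) m) * M.majorant y (-(m / r + 1 : ℕ) * r) (r - m % r) :=
        hstart ▸ M.supLkh_add_le y _ _ _
    _ ≤ _ := by
        gcongr
        exact M.majorant_le_of_le y (by omega) (by omega)

/-- Linear control, with slope `c` and intercept `C₀`, of the logarithms of the upper and lower
bounds for the likelihoods, and of the number of bad blocks, over the windows of the path `y` that
contain the origin. -/
structure PathControl (r : ℕ) (K : Set (Fin r → S)) (D : Set X) (c C₀ : ℝ) (y : ℤ → S) :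
    Prop where
  slope_nonneg : 0 ≤ c
  intercept_nonneg : 0 ≤ C₀
  majorant_le : ∀ p q : ℕ, M.majorant y (-p) (p + q) ≤ expE (c * (p + q) + C₀)
  le_prodInf : ∀ p q : ℕ, expE (-(c * (p + q) + C₀)) ≤ M.prodInf r D y (-p) (p + q)
  badCount_le : ∀ p q : ℕ, (badCount K y (-p) (p + q) : ℝ) ≤ (p + q) / 3 + C₀

/-- Linear control of the logarithm of the mass that `χ` sends to `D` over the windows
`[-m, -m + l)`, `l ≤ r`, of the path `y`. -/
def InitControl (r : ℕ) (D : Set X) (χ : ProbabilityMeasure X) (C₀ : ℝ) (y : ℤ → S) : Prop :=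
  ∀ l ≤ r, ∀ m : ℕ, expE (-(m + C₀)) ≤ M.push χ (block y (-m) l) D

variable {M} {K : Set (Fin r → S)} {c C₀ : ℝ} {y}

lemma PathControl.mono (h : M.PathControl r K D c C₀ y) {C₁ : ℝ} (hC : C₀ ≤ C₁) :
    M.PathControl r K D c C₁ y where
  slope_nonneg := h.slope_nonneg
  intercept_nonneg := h.intercept_nonneg.trans hC
  majorant_le p q := (h.majorant_le p q).trans (expE_mono (by linarith))
  le_prodInf p q := (expE_mono (by linarith)).trans (h.le_prodInf p q)
  badCount_le p q := (h.badCount_le p q).trans (by linarith)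

lemma InitControl.mono {χ : ProbabilityMeasure X} (h : M.InitControl r D χ C₀ y) {C₁ : ℝ}
    (hC : C₀ ≤ C₁) : M.InitControl r D χ C₁ y := fun l hl m =>
  (expE_mono (by linarith)).trans (h l hl m)

lemma PathControl.majorant_ne_top (h : M.PathControl r K D c C₀ y) (j : ℤ) (n : ℕ) :
    M.majorant y j n ≠ ∞ :=
  ne_top_of_le_ne_top (expE_ne_top _)
    ((M.majorant_le_of_le y (by omega) (by omega)).trans
      (h.majorant_le j.natAbs (j.natAbs + n)))

lemma intercept_le_and_le_of_long {n : ℝ} (hr : 0 < r) (hC : 0 ≤ C₀)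
    (hn : 24 * r * (C₀ + 1) ≤ n) : 24 * (C₀ + 1) ≤ n ∧ 24 * (r : ℝ) ≤ n := by
  have hr1 : (1 : ℝ) ≤ r := by exact_mod_cast hr
  constructor <;> nlinarith

variable {m k n : ℕ}

/- The windows that enter the estimates for `[-m, k]` and `[-m - 1, k]` all have lengths between
`m + k` and `m + k + 2`; `n` stands for the common reference length. -/
lemma PathControl.majorant_le_of_long (h : M.PathControl r K D c C₀ y) (hr : 0 < r)
    (hn : 24 * r * (C₀ + 1) ≤ n) {j : ℤ} {e p q : ℕ} (hj : -(p : ℤ) ≤ j) (he : j + e ≤ q)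
    (hpq : p + q ≤ n + 1) : M.majorant y j e ≤ expE (2 * ((c + 1) * n)) := by
  refine ((M.majorant_le_of_le y hj (by push_cast; omega)).trans (h.majorant_le p q)).trans
    (expE_mono ?_)
  have hc := h.slope_nonneg
  have hC := h.intercept_nonneg
  have hpq' : (p + q : ℝ) ≤ n + 1 := by exact_mod_cast hpq
  obtain ⟨hCn, -⟩ := intercept_le_and_le_of_long hr hC hn
  have : c * (p + q) ≤ c * (2 * n) := by gcongr; linarith
  linarith

lemma PathControl.le_lik_of_long (h : M.PathControl r K D c C₀ y) (hD : MeasurableSet D)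
    (hr : 0 < r) {χ : ProbabilityMeasure X} (hχ : M.InitControl r D χ C₀ y)
    (hn : 24 * r * (C₀ + 1) ≤ n) (hle : m + k ≤ n + 2) :
    expE (-(4 * ((c + 1) * n))) ≤ M.lik χ (block y (-m) (m + k)) := by
  have hc := h.slope_nonneg
  have hlow : expE (-(m + C₀) + -(c * (m + (k + 1)) + C₀)) ≤
      M.push χ (block y (-m) (m % r)) D *
        M.prodInf r D y (-(m / r : ℕ)) (m / r + (k / r + 1)) := by
    rw [expE_add]
    refine mul_le_mul' (hχ _ (Nat.mod_lt m hr).le m) ((expE_mono ?_).trans (h.le_prodInf _ _))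
    gcongr
    · exact_mod_cast Nat.div_le_self m r
    · exact_mod_cast Nat.succ_le_succ (Nat.div_le_self k r)
  refine (expE_mono ?_).trans (expE_sub_le_of_expE_le_mul
    (hlow.trans (M.push_mul_prodInf_le_lik_mul_majorant y hD hr χ m k)) (h.majorant_le m (k + r)))
  obtain ⟨hCn, hrn⟩ := intercept_le_and_le_of_long hr h.intercept_nonneg hn
  have hC := h.intercept_nonneg
  have hle' : (m + k : ℝ) ≤ n + 2 := by exact_mod_cast hle
  have hsum : c * ((m + (k + 1)) + (m + (k + r))) ≤ c * (4 * n) := by gcongr; linarith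
  push_cast
  linarith [show (0 : ℝ) ≤ k from k.cast_nonneg]

lemma PathControl.le_supLkh_of_long (h : M.PathControl r K D c C₀ y) (hD : MeasurableSet D)
    (hne : D.Nonempty) (hr : 0 < r) (hm : 24 * r * (C₀ + 1) ≤ m) :
    expE (-(4 * ((c + 1) * m))) ≤ M.supLkh (block y (-m) m) := by
  have hlow := (h.le_prodInf (m / r + 1) 0).trans (M.prodInf_le_supLkh_mul_majorant y hD hne hr m)
  refine (expE_mono ?_).trans (expE_sub_le_of_expE_le_mul hlow (h.majorant_le (m + r) 0))
  obtain ⟨hCm, hrm⟩ := intercept_le_and_le_of_long hr h.intercept_nonneg hm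
  have hc := h.slope_nonneg
  have hC := h.intercept_nonneg
  have hdiv : ((m / r : ℕ) : ℝ) ≤ m := by exact_mod_cast Nat.div_le_self m r
  have hsum : c * (((m / r : ℕ) + 1) + (m + r)) ≤ c * (4 * m) := by gcongr; linarith
  rw [Nat.cast_succ, Nat.cast_add, Nat.cast_zero, add_zero, add_zero]
  linarith

end HMM

lemma log_div_sub_log_div_le {a b a' b' θ τ ρ : ℝ} (ha : 0 < a) (hb : 0 < b) (ha' : 0 < a')
    (hb' : 0 < b') (hθ : 0 ≤ θ) (hτ : 0 ≤ τ) (hθρ : θ ≤ ρ) (hρ : ρ < 1)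
    (h : a * b' ≤ b * a' + (θ * (a * b' + b * a') + τ * (b * a'))) :
    Real.log (a / b) - Real.log (a' / b') ≤ (2 * θ + τ) / (1 - ρ) := by
  have hba : 0 < b * a' := mul_pos hb ha'
  obtain ⟨x, hx⟩ : ∃ x, a * b' / (b * a') = x := ⟨_, rfl⟩
  have hx0 : 0 < x := hx ▸ div_pos (mul_pos ha hb') hba
  have hlog : Real.log (a / b) - Real.log (a' / b') = Real.log x := by
    rw [← Real.log_div (div_pos ha hb).ne' (div_pos ha' hb').ne', div_div_div_eq, hx]
  have hle : (x - 1) * (1 - θ) ≤ 2 * θ + τ := by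
    rw [(div_eq_iff hba.ne').1 hx] at h
    have : x ≤ 1 + (θ * (x + 1) + τ) := le_of_mul_le_mul_right (by linarith) hba
    linarith
  rw [hlog]
  refine (Real.log_le_sub_one_of_pos hx0).trans ((le_div_iff₀ (sub_pos.2 hρ)).2 ?_)
  rcases le_total x 1 with hx1 | hx1
  · exact (mul_nonpos_of_nonpos_of_nonneg (by linarith) (by linarith)).trans (by linarith)
  · exact (mul_le_mul_of_nonneg_left (by linarith) (by linarith)).trans hle

lemma log_toReal_div_sub_log_toReal_div_le {a b a' b' θ τ ρ : ℝ≥0∞} (ha : 0 < a.toReal)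
    (hb : 0 < b.toReal) (ha' : 0 < a'.toReal) (hb' : 0 < b'.toReal) (hτ : τ ≠ ∞) (hθρ : θ ≤ ρ)
    (hρ : ρ < 1) (h : a * b' ≤ b * a' + (θ * (a * b' + b * a') + τ * (b * a'))) :
    Real.log (a.toReal / b.toReal) - Real.log (a'.toReal / b'.toReal) ≤
      (2 * θ.toReal + τ.toReal) / (1 - ρ.toReal) := by
  have hρ' : ρ ≠ ∞ := hρ.ne_top
  have hθ : θ ≠ ∞ := ne_top_of_le_ne_top hρ' hθρ
  have hat := (ENNReal.toReal_pos_iff.1 ha).2.ne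
  have hbt := (ENNReal.toReal_pos_iff.1 hb).2.ne
  have hat' := (ENNReal.toReal_pos_iff.1 ha').2.ne
  have hbt' := (ENNReal.toReal_pos_iff.1 hb').2.ne
  refine log_div_sub_log_div_le ha hb ha' hb' ENNReal.toReal_nonneg ENNReal.toReal_nonneg
    (ENNReal.toReal_mono hρ' hθρ) ((ENNReal.toReal_lt_toReal hρ' ENNReal.one_ne_top).2 hρ) ?_
  have hreal := ENNReal.toReal_mono (by finiteness) h
  simpa only [ENNReal.toReal_mul, ENNReal.toReal_add (show b * a' ≠ ∞ by finiteness)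
    (show θ * (a * b' + b * a') + τ * (b * a') ≠ ∞ by finiteness),
    ENNReal.toReal_add (show θ * (a * b' + b * a') ≠ ∞ by finiteness)
    (show τ * (b * a') ≠ ∞ by finiteness), ENNReal.toReal_add (show a * b' ≠ ∞ by finiteness)
    (show b * a' ≠ ∞ by finiteness)] using hreal

namespace HMM

/-- The geometric rate of forgetting for blocks of length `r` and contraction factor `ρ`: windows of
length `n` contain a net number of at least `n / (12 * r)` contractions, and all the other error
terms are at most `exp (-n)`. -/
noncomputable def rate (r : ℕ) (ρ : ℝ≥0∞) : ℝ :=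
  max (ρ.toReal ^ (1 / (12 * r : ℝ))) (Real.exp (-1))

variable {r : ℕ} {ρ : ℝ≥0∞}

lemma rate_pos (r : ℕ) (ρ : ℝ≥0∞) : 0 < rate r ρ := lt_max_of_lt_right (Real.exp_pos _)

lemma rate_lt_one (hr : 0 < r) (hρ : ρ < 1) : rate r ρ < 1 :=
  max_lt (Real.rpow_lt_one ENNReal.toReal_nonneg
    ((ENNReal.toReal_lt_toReal hρ.ne_top ENNReal.one_ne_top).2 hρ) (by positivity)) (by simp)

lemma exp_neg_le_rate_pow (r : ℕ) (ρ : ℝ≥0∞) (n : ℕ) : Real.exp (-n) ≤ rate r ρ ^ n :=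
  calc Real.exp (-n) = Real.exp (-1) ^ n := by rw [← Real.exp_nat_mul, mul_neg_one]
    _ ≤ rate r ρ ^ n := pow_le_pow_left₀ (Real.exp_pos _).le (le_max_right _ _) n

lemma toReal_pow_le_rate_pow (hρ0 : 0 < ρ) (hρ : ρ < 1) {n e : ℕ} (he : (n : ℝ) / (12 * r) ≤ e) :
    (ρ ^ e).toReal ≤ rate r ρ ^ n := by
  have h0 : 0 < ρ.toReal := ENNReal.toReal_pos hρ0.ne' hρ.ne_top
  have h1 : ρ.toReal ≤ 1 := ENNReal.toReal_mono ENNReal.one_ne_top hρ.le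
  calc (ρ ^ e).toReal = ρ.toReal ^ (e : ℝ) := by rw [ENNReal.toReal_pow, Real.rpow_natCast]
    _ ≤ ρ.toReal ^ ((n : ℝ) / (12 * r)) := Real.rpow_le_rpow_of_exponent_ge h0 h1 he
    _ = (ρ.toReal ^ (1 / (12 * r : ℝ))) ^ n := by
        rw [← Real.rpow_natCast, ← Real.rpow_mul h0.le, one_div_mul_eq_div]
    _ ≤ rate r ρ ^ n := pow_le_pow_left₀ (Real.rpow_nonneg h0.le _) (le_max_left _ _) n

/-- The leakage out of the local Doeblin set that can be tolerated when the likelihoods grow at most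
at the exponential rate `c`: at least `n / (48 * r)` leakages in a window of length `n` outweigh the
bound `exp (4 * (c + 1) * n)` for the squared total mass, with a factor
`exp (-13 * (c + 1) * n)` to spare. -/
noncomputable def leakage (r : ℕ) (c : ℝ) : ℝ≥0∞ := expE (-(48 * r * (17 * (c + 1))))

lemma leakage_pow_le {c : ℝ} (hc : 0 ≤ c) {n t : ℕ} (hn : n ≤ 48 * r * t) :
    leakage r c ^ t ≤ expE (-(17 * ((c + 1) * n))) := by
  rw [leakage, expE_pow]
  refine expE_mono ?_
  have hn' : (n : ℝ) ≤ 48 * r * t := by exact_mod_cast hn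
  have := mul_le_mul_of_nonneg_left hn' (show 0 ≤ 17 * (c + 1) by linarith)
  linarith

/- Of the `N` blocks fewer than `N / 3 + C₀` are bad, and each of them spoils two steps; of the
remaining ones `2 * t` contractions are traded for `t` leakages. -/
lemma exists_mixing_exponents {m k B : ℕ} {C₀ : ℝ} (hr : 0 < r) (hC : 0 ≤ C₀)
    (hn : 24 * r * (C₀ + 1) ≤ (m + k : ℕ)) (hB : (B : ℝ) ≤ (m / r + k / r : ℕ) / 3 + C₀) :
    ∃ t : ℕ, m + k ≤ 48 * r * t ∧ 1 ≤ m / r + k / r - (2 * B + 1) - 2 * t ∧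
      ((m + k : ℕ) : ℝ) / (12 * r) ≤ (m / r + k / r - (2 * B + 1) - 2 * t : ℕ) := by
  obtain ⟨N, hN⟩ : ∃ N, m / r + k / r = N := ⟨_, rfl⟩
  rw [hN] at hB ⊢
  have hr0 : (0 : ℝ) < r := by exact_mod_cast hr
  have hmk : m + k ≤ (N + 2) * r := by
    have := Nat.mod_add_div' m r
    have := Nat.mod_add_div' k r
    have := Nat.mod_lt m hr
    have := Nat.mod_lt k hr
    have : (N + 2) * r = m / r * r + k / r * r + 2 * r := by rw [← hN]; ring
    omega
  have hCN : 24 * (C₀ + 1) ≤ N + 2 := by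
    have : ((m + k : ℕ) : ℝ) ≤ (N + 2) * r := by exact_mod_cast hmk
    nlinarith
  have hN22 : 22 ≤ N := by
    have : (22 : ℝ) ≤ N := by linarith
    exact_mod_cast this
  have ht : (12 * (N / 12 : ℕ) : ℝ) ≤ N := by exact_mod_cast Nat.mul_div_le N 12
  have hsub : 2 * B + 1 + 2 * (N / 12) ≤ N := by
    have : (2 * B + 1 + 2 * (N / 12 : ℕ) : ℝ) ≤ N := by linarith
    exact_mod_cast this
  have he : ((N - (2 * B + 1) - 2 * (N / 12) : ℕ) : ℝ) = N - (2 * B + 1) - 2 * (N / 12 : ℕ) := by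
    rw [Nat.cast_sub (by omega), Nat.cast_sub (by omega)]; push_cast; ring
  have heN : (N + 2 : ℝ) / 12 ≤ (N - (2 * B + 1) - 2 * (N / 12) : ℕ) := by rw [he]; linarith
  refine ⟨N / 12, ?_, ?_, ?_⟩
  · calc m + k ≤ (N + 2) * r := hmk
      _ ≤ (48 * (N / 12)) * r := by gcongr; omega
      _ = 48 * r * (N / 12) := by ring
  · have : (0 : ℝ) < (N - (2 * B + 1) - 2 * (N / 12) : ℕ) := by linarith
    exact_mod_cast this
  · calc ((m + k : ℕ) : ℝ) / (12 * r) ≤ ((N + 2) * r) / (12 * r) := by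
          gcongr; exact_mod_cast hmk
      _ = (N + 2) / 12 := mul_div_mul_right _ _ hr0.ne'
      _ ≤ _ := heN

variable {X S : Type*} [MeasurableSpace X] [MeasurableSpace S]

section Mixing

variable {M : HMM X S} {K : Set (Fin r → S)} {D : Set X} {c C₀ : ℝ} {y : ℤ → S} {m k : ℕ}

theorem PathControl.exists_wlik_mul_le (h : M.PathControl r K D c C₀ y) (hr : 0 < r)
    (hmix : M.IsMixing r K ρ (leakage r c)) (hn : 24 * r * (C₀ + 1) ≤ (m + k : ℕ))
    {a b : X → ℝ≥0∞} {s : ℝ≥0∞} (ha : Measurable a) (hb : Measurable b)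
    (hs : ∀ x x', a x * b x' ≤ s) :
    ∃ e : ℕ, 1 ≤ e ∧ ((m + k : ℕ) : ℝ) / (12 * r) ≤ e ∧
      ∀ (μ μ' : Measure X) [IsFiniteMeasure μ] [IsFiniteMeasure μ'],
        M.wlik y μ (-m) (m + k) a * M.wlik y μ' (-m) (m + k) b ≤
          M.wlik y μ (-m) (m + k) b * M.wlik y μ' (-m) (m + k) a +
          (ρ ^ e * (M.wlik y μ (-m) (m + k) a * M.wlik y μ' (-m) (m + k) b +
            M.wlik y μ (-m) (m + k) b * M.wlik y μ' (-m) (m + k) a) +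
          expE (-(13 * ((c + 1) * (m + k : ℕ)))) * s * (μ Set.univ * μ' Set.univ)) := by
  have hB : (badCount K y (-(m / r : ℕ)) (m / r + k / r) : ℝ) ≤
      (m / r + k / r : ℕ) / 3 + C₀ := by
    rw [Nat.cast_add]; exact h.badCount_le (m / r) (k / r)
  obtain ⟨t, ht, he1, he⟩ := exists_mixing_exponents hr h.intercept_nonneg hn hB
  refine ⟨_, he1, he, fun μ μ' _ _ => ?_⟩
  have hmaj : M.majorant y (-m) (m + k) ≤ expE (2 * ((c + 1) * (m + k : ℕ))) :=
    h.majorant_le_of_long hr hn le_rfl (q := k) (by push_cast; omega) (by omega)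
  have hleak : leakage r c ^ t * (M.majorant y (-m) (m + k) * M.majorant y (-m) (m + k) * s) ≤
      expE (-(13 * ((c + 1) * (m + k : ℕ)))) * s :=
    calc _ ≤ expE (-(17 * ((c + 1) * (m + k : ℕ)))) *
          (expE (2 * ((c + 1) * (m + k : ℕ))) * expE (2 * ((c + 1) * (m + k : ℕ))) * s) := by
          gcongr; exact leakage_pow_le h.slope_nonneg ht
      _ = _ := by
          rw [← expE_add, ← mul_assoc, ← expE_add]
          congr 2
          ring
  refine ((hmix.mixes_act h.majorant_ne_top (Mixes.of_mul_le ha hb hs) m k).lintegral_le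
    μ μ' t).trans ?_
  rw [wlik, wlik, wlik, wlik]
  gcongr

lemma expE_mul_le_of_le_mul (hc : 0 ≤ c) {n : ℕ} {u v w : ℝ≥0∞}
    (h : u * v ≤ 2 * expE (12 * ((c + 1) * n)) * w) :
    expE (-(13 * ((c + 1) * n))) * u * v ≤ 2 * expE (-n) * w :=
  calc expE (-(13 * ((c + 1) * n))) * u * v
      ≤ expE (-(13 * ((c + 1) * n))) * (2 * expE (12 * ((c + 1) * n)) * w) := by
        rw [mul_assoc]; gcongr
    _ = 2 * expE (-(13 * ((c + 1) * n)) + 12 * ((c + 1) * n)) * w := by rw [expE_add]; ring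
    _ ≤ 2 * expE (-n) * w := by
        gcongr
        refine expE_mono ?_
        have : 0 ≤ c * n := by positivity
        linarith

/- The hypothesis `hlow` says that the likelihoods are not too small; it turns the absolute error
`expE (-13 * (c + 1) * n)` of the mixing bound into a relative one. -/
theorem PathControl.log_wlik_div_sub_le (h : M.PathControl r K D c C₀ y) (hr : 0 < r)
    (hg : ∀ x y, 0 < M.g x y) (hmix : M.IsMixing r K ρ (leakage r c))
    (hn : 24 * r * (C₀ + 1) ≤ (m + k : ℕ)) {μ μ' : Measure X} [IsFiniteMeasure μ]
    [IsFiniteMeasure μ'] (hμ : μ ≠ 0) (hμ' : μ' ≠ 0)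
    (hlow : M.supG (y k) * (μ Set.univ * μ' Set.univ) ≤
      2 * expE (12 * ((c + 1) * (m + k : ℕ))) *
        (M.wlik y μ (-m) (m + k) (fun _ => 1) * M.wlik y μ' (-m) (m + k) (M.g · (y k)))) :
    Real.log ((M.wlik y μ (-m) (m + k) (M.g · (y k))).toReal /
        (M.wlik y μ (-m) (m + k) fun _ => 1).toReal) -
      Real.log ((M.wlik y μ' (-m) (m + k) (M.g · (y k))).toReal /
        (M.wlik y μ' (-m) (m + k) fun _ => 1).toReal) ≤
      4 / (1 - ρ.toReal) * rate r ρ ^ (k + m) := by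
  have hG : M.supG (y k) ≠ ∞ :=
    ne_top_of_le_ne_top (h.majorant_ne_top k 1) (M.supG_le_majorant y k)
  have hgm := M.measurable_g_left (y k)
  have hgpos (x : X) : 0 < (M.g x (y k) : ℝ≥0∞) := ENNReal.coe_pos.2 (hg x (y k))
  obtain ⟨e, he1, he, hle⟩ := h.exists_wlik_mul_le hr hmix hn hgm (b := fun _ => 1)
    measurable_const (s := M.supG (y k)) fun x _ => (mul_one _).trans_le (M.g_le_supG x (y k))
  have hwg {ν : Measure X} [IsFiniteMeasure ν] (hν : ν ≠ 0) :=
    M.toReal_wlik_pos y hg (h.majorant_ne_top (-m) (m + k)) hν hgm hgpos hG fun x =>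
      M.g_le_supG x (y k)
  have hw1 {ν : Measure X} [IsFiniteMeasure ν] (hν : ν ≠ 0) :=
    M.toReal_wlik_pos y hg (h.majorant_ne_top (-m) (m + k)) hν measurable_const
      (fun _ => one_pos) ENNReal.one_ne_top fun _ => le_rfl
  have hρ := hmix.lt_one
  refine (log_toReal_div_sub_log_toReal_div_le (τ := 2 * expE (-((m + k : ℕ) : ℝ)))
    (hwg hμ) (hw1 hμ) (hwg hμ') (hw1 hμ') (by finiteness [expE_ne_top (-((m + k : ℕ) : ℝ))])
    (pow_le_of_le_one zero_le hρ.le (Nat.one_le_iff_ne_zero.1 he1)) hρ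
    ((hle μ μ').trans ?_)).trans ?_
  · gcongr _ + (_ + ?_)
    exact expE_mul_le_of_le_mul h.slope_nonneg hlow
  · rw [div_mul_eq_mul_div, add_comm k m, ENNReal.toReal_mul, toReal_expE, ENNReal.toReal_ofNat]
    have hpow := toReal_pow_le_rate_pow hmix.pos hρ he
    have hexp := exp_neg_le_rate_pow r ρ (m + k)
    have hρ1 : ρ.toReal < 1 := (ENNReal.toReal_lt_toReal hρ.ne_top ENNReal.one_ne_top).2 hρ
    exact div_le_div_of_nonneg_right (by linarith) (by linarith)

end Mixing

section OneStep

variable (M : HMM X S) (y : ℤ → S) (χ : ProbabilityMeasure X) (j : ℤ) (n : ℕ)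

lemma lik_block_succ :
    M.lik χ (block y j (n + 1)) = M.wlik y χ j n (M.g · (y (j + n))) := by
  rw [lik_eq_wlik, wlik, act_succ_one]; rfl

lemma logPredLik_block :
    M.logPredLik χ (block y j (n + 1)) =
      Real.log ((M.wlik y χ j n (M.g · (y (j + n)))).toReal /
        (M.wlik y χ j n fun _ => 1).toReal) := by
  rw [logPredLik, init_block, lik_block_succ, lik_eq_wlik]

lemma lik_block_pred :
    M.lik χ (block y (j - 1) (n + 1)) =
      M.wlik y (M.push χ (block y (j - 1) 1)) j n fun _ => 1 := by
  rw [add_comm n 1, lik_add, Nat.cast_one, sub_add_cancel]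

lemma lik_block_pred_succ :
    M.lik χ (block y (j - 1) (n + 2)) =
      M.wlik y (M.push χ (block y (j - 1) 1)) j n (M.g · (y (j + n))) := by
  rw [lik_block_pred, wlik, act_succ_one]; rfl

lemma logPredLik_block_pred :
    M.logPredLik χ (block y (j - 1) (n + 2)) =
      Real.log ((M.wlik y (M.push χ (block y (j - 1) 1)) j n (M.g · (y (j + n)))).toReal /
        (M.wlik y (M.push χ (block y (j - 1) 1)) j n fun _ => 1).toReal) := by
  rw [← lik_block_pred_succ, ← lik_block_pred, logPredLik, init_block]

lemma mem_nearSet_block {χt : ProbabilityMeasure X} :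
    χt ∈ M.nearSet (block y j (n + 1)) χ ↔
      1 / 2 * M.lik χ (block y j (n + 1)) ≤ M.supG (y (j + n)) * M.lik χt (block y j n) := by
  rw [nearSet, Set.mem_ofPred_eq, init_block, block_apply_last]

end OneStep

lemma le_two_mul_expE_mul {u : ℝ} {a b g l : ℝ≥0∞} (hg : g ≤ expE (2 * u))
    (hl : expE (-(4 * u)) ≤ l) (hb : 1 / 2 * l ≤ g * b) (ha : expE (-(4 * u)) ≤ a) :
    g ≤ 2 * expE (12 * u) * (b * a) := by
  have hl' : l ≤ 2 * (expE (2 * u) * b) :=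
    calc l = 2 * (1 / 2 * l) := by
          rw [← mul_assoc, one_div, ENNReal.mul_inv_cancel two_ne_zero ENNReal.ofNat_ne_top,
            one_mul]
      _ ≤ 2 * (expE (2 * u) * b) := by gcongr 2 * ?_; exact hb.trans (by gcongr)
  calc g ≤ expE (10 * u + (-(4 * u) + -(4 * u))) := hg.trans_eq (by congr 1; ring)
    _ = expE (10 * u) * (expE (-(4 * u)) * expE (-(4 * u))) := by rw [expE_add, expE_add]
    _ ≤ expE (10 * u) * (2 * (expE (2 * u) * b) * a) := by gcongr; exact hl.trans hl'
    _ = 2 * expE (10 * u + 2 * u) * (b * a) := by rw [expE_add]; ring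
    _ = 2 * expE (12 * u) * (b * a) := by congr 3; ring

lemma mul_le_two_mul_expE_mul {u : ℝ} {a b g l : ℝ≥0∞} (hg : g ≤ expE (2 * u))
    (hl : l ≤ expE (2 * u)) (ha : expE (-(4 * u)) ≤ a) (hb : expE (-(4 * u)) ≤ b) :
    g * l ≤ 2 * expE (12 * u) * (a * b) :=
  calc g * l ≤ expE (2 * u) * expE (2 * u) := mul_le_mul' hg hl
    _ = expE (12 * u) * (expE (-(4 * u)) * expE (-(4 * u))) := by
      rw [← expE_add, ← expE_add, ← expE_add]; congr 1; ring
    _ ≤ 2 * expE (12 * u) * (a * b) := by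
      gcongr; exact le_mul_of_one_le_left zero_le one_le_two

variable {M : HMM X S} {K : Set (Fin r → S)} {D : Set X} {c C₀ : ℝ} {y : ℤ → S}
  {χ χ' χt : ProbabilityMeasure X} {m k : ℕ}

lemma neg_natCast_add_natCast_add (m k : ℕ) : -(m : ℤ) + (m + k : ℕ) = k := by
  rw [Nat.cast_add, neg_add_cancel_left]

lemma PathControl.supG_le_of_long (h : M.PathControl r K D c C₀ y) (hr : 0 < r)
    (hn : 24 * r * (C₀ + 1) ≤ (m + k : ℕ)) :
    M.supG (y k) ≤ expE (2 * ((c + 1) * (m + k : ℕ))) :=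
  (M.supG_le_majorant y k).trans
    (h.majorant_le_of_long hr hn (p := 0) (q := k + 1) (by simp) (by simp) (by omega))

lemma PathControl.push_univ_le_of_long (h : M.PathControl r K D c C₀ y) (hr : 0 < r)
    (hn : 24 * r * (C₀ + 1) ≤ (m + k : ℕ)) :
    M.push χ (block y (-m - 1) 1) Set.univ ≤ expE (2 * ((c + 1) * (m + k : ℕ))) :=
  (M.push_univ_le y χ (-m - 1) 1).trans
    (h.majorant_le_of_long hr hn (p := m + 1) (q := 0) (by omega) (by omega) (by omega))

theorem PathControl.logPredLik_sub_le_of_long (h : M.PathControl r K D c C₀ y)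
    (hD : MeasurableSet D) (hr : 0 < r) (hg : ∀ x y, 0 < M.g x y)
    (hmix : M.IsMixing r K ρ (leakage r c)) (hχ : M.InitControl r D χ C₀ y)
    (hχ' : M.InitControl r D χ' C₀ y) (hn : 24 * r * (C₀ + 1) ≤ (m + k : ℕ))
    (hχt : χt ∈ M.nearSet (block y (-m) (m + k + 1)) χ) :
    M.logPredLik χt (block y (-m) (m + k + 1)) - M.logPredLik χ' (block y (-m) (m + k + 1)) ≤
      4 / (1 - ρ.toReal) * rate r ρ ^ (k + m) := by
  have hl := h.le_lik_of_long hD hr hχ (m := m) (k := k + 1) hn (by omega)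
  have hl' := h.le_lik_of_long hD hr hχ' (m := m) (k := k + 1) hn (by omega)
  rw [mem_nearSet_block, neg_natCast_add_natCast_add] at hχt
  rw [logPredLik_block, logPredLik_block, neg_natCast_add_natCast_add]
  refine h.log_wlik_div_sub_le hr hg hmix hn (NeZero.ne _) (NeZero.ne _) ?_
  have hlow := le_two_mul_expE_mul (h.supG_le_of_long hr hn) hl hχt hl'
  rw [← add_assoc, lik_eq_wlik, lik_block_succ, neg_natCast_add_natCast_add] at hlow
  rwa [measure_univ, measure_univ, mul_one, mul_one]

theorem PathControl.abs_logPredLik_sub_le_of_long (h : M.PathControl r K D c C₀ y)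
    (hD : MeasurableSet D) (hr : 0 < r) (hg : ∀ x y, 0 < M.g x y)
    (hmix : M.IsMixing r K ρ (leakage r c)) (hχ : M.InitControl r D χ C₀ y)
    (hn : 24 * r * (C₀ + 1) ≤ (m + k : ℕ)) :
    |M.logPredLik χ (block y (-m) (m + k + 1)) - M.logPredLik χ (block y (-m - 1) (m + k + 2))| ≤
      4 / (1 - ρ.toReal) * rate r ρ ^ (k + m) := by
  have hG := h.supG_le_of_long hr hn
  have hp := h.push_univ_le_of_long (χ := χ) hr hn
  have : IsFiniteMeasure (M.push χ (block y (-m - 1) 1)) := ⟨hp.trans_lt (expE_ne_top _).lt_top⟩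
  have hp0 : M.push χ (block y (-m - 1) 1) ≠ 0 :=
    Measure.measure_univ_ne_zero.1 (M.lik_pos y hg χ (-m - 1) 1).ne'
  have hl₁ := h.le_lik_of_long hD hr hχ (m := m) (k := k) hn (by omega)
  have hl₂ := h.le_lik_of_long hD hr hχ (m := m) (k := k + 1) hn (by omega)
  have hl₃ := h.le_lik_of_long hD hr hχ (m := m + 1) (k := k) hn (by omega)
  have hl₄ := h.le_lik_of_long hD hr hχ (m := m + 1) (k := k + 1) hn (by omega)
  have hstart : -((m + 1 : ℕ) : ℤ) = -m - 1 := by omega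
  rw [lik_eq_wlik] at hl₁
  rw [← add_assoc, lik_block_succ, neg_natCast_add_natCast_add] at hl₂
  rw [hstart, Nat.add_right_comm, lik_block_pred] at hl₃
  rw [hstart, add_add_add_comm, lik_block_pred_succ, neg_natCast_add_natCast_add] at hl₄
  rw [logPredLik_block, logPredLik_block_pred, neg_natCast_add_natCast_add, abs_sub_le_iff]
  constructor
  · refine h.log_wlik_div_sub_le hr hg hmix hn (NeZero.ne _) hp0 ?_
    rw [measure_univ (μ := (χ : Measure X)), one_mul]
    exact mul_le_two_mul_expE_mul hG hp hl₁ hl₄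
  · refine h.log_wlik_div_sub_le hr hg hmix hn hp0 (NeZero.ne _) ?_
    rw [measure_univ (μ := (χ : Measure X)), mul_one]
    exact mul_le_two_mul_expE_mul hG hp hl₃ hl₂

end HMM

lemma toReal_lintegral_ofReal_add_const {X : Type*} [MeasurableSpace X] {μ : Measure X}
    [IsFiniteMeasure μ] {f : X → ℝ} (hf : Integrable f μ) {B : ℝ} (hB : ∀ x, |f x| ≤ B) :
    (∫⁻ x, ENNReal.ofReal (f x + B) ∂μ).toReal = ∫ x, f x ∂μ + μ.real Set.univ * B := by
  have hnonneg (x : X) : 0 ≤ f x + B := by linarith [neg_le_of_abs_le (hB x)]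
  rw [← integral_eq_lintegral_of_nonneg_ae (.of_forall hnonneg)
    (hf.add (integrable_const B)).aestronglyMeasurable, integral_add hf (integrable_const B),
    integral_const, smul_eq_mul]

namespace HMM

variable {X S : Type*} [MeasurableSpace X] [MeasurableSpace S]

section Delta

variable (M : HMM X S) {n : ℕ} {z : Fin n → S} {f : X → ℝ} {B : ℝ}

lemma lintegral_ofReal_push_le (hB : ∀ x, |f x| ≤ B) (χ : ProbabilityMeasure X) :
    ∫⁻ x, ENNReal.ofReal (f x + B) ∂M.push χ z ≤ ENNReal.ofReal (2 * B) * M.supLkh z :=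
  calc ∫⁻ x, ENNReal.ofReal (f x + B) ∂M.push χ z
      ≤ ∫⁻ _, ENNReal.ofReal (2 * B) ∂M.push χ z := by
        gcongr with x; linarith [le_of_abs_le (hB x)]
    _ = ENNReal.ofReal (2 * B) * M.lik χ z := lintegral_const _
    _ ≤ ENNReal.ofReal (2 * B) * M.supLkh z := by gcongr; exact M.lik_le_supLkh χ z

lemma lintegral_ofReal_push_mul_lik_le (hB : ∀ x, |f x| ≤ B) (χ χ' : ProbabilityMeasure X) :
    (∫⁻ x, ENNReal.ofReal (f x + B) ∂M.push χ z) * M.lik χ' z ≤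
      ENNReal.ofReal (2 * B) * M.supLkh z ^ 2 := by
  rw [sq, ← mul_assoc]
  exact mul_le_mul' (M.lintegral_ofReal_push_le hB χ) (M.lik_le_supLkh χ' z)

/- Adding a constant multiple of `1` to `f` does not change `Δ(f, 1)`, so that `f` may be replaced
by the nonnegative function `f + B`. -/
lemma Delta_one_le (hz : M.supLkh z ≠ ∞) (hf : Measurable f) (hB : ∀ x, |f x| ≤ B)
    {χ χ' : ProbabilityMeasure X} {τ : ℝ≥0∞} (hτ : τ ≠ ∞)
    (h : (∫⁻ x, ENNReal.ofReal (f x + B) ∂M.push χ z) * M.lik χ' z ≤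
      M.lik χ z * (∫⁻ x, ENNReal.ofReal (f x + B) ∂M.push χ' z) + τ) :
    M.Delta χ χ' z f (fun _ => 1) ≤ τ.toReal := by
  have hlik (χ : ProbabilityMeasure X) : M.lik χ z ≠ ∞ :=
    ne_top_of_le_ne_top hz (M.lik_le_supLkh χ z)
  have hfin (χ : ProbabilityMeasure X) : IsFiniteMeasure (M.push χ z) := ⟨(hlik χ).lt_top⟩
  have hint (χ : ProbabilityMeasure X) : Integrable f (M.push χ z) :=
    (integrable_const B).mono' hf.aestronglyMeasurable (.of_forall hB)
  have hne (χ : ProbabilityMeasure X) : ∫⁻ x, ENNReal.ofReal (f x + B) ∂M.push χ z ≠ ∞ :=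
    ((hint χ).add (integrable_const B)).lintegral_lt_top.ne
  have hone (χ : ProbabilityMeasure X) : ∫ _, (1 : ℝ) ∂M.push χ z = (M.lik χ z).toReal := by
    rw [integral_const, smul_eq_mul, mul_one]; rfl
  have hreal := ENNReal.toReal_mono
    (ENNReal.add_ne_top.2 ⟨ENNReal.mul_ne_top (hlik χ) (hne χ'), hτ⟩) h
  rw [ENNReal.toReal_add (ENNReal.mul_ne_top (hlik χ) (hne χ')) hτ, ENNReal.toReal_mul,
    ENNReal.toReal_mul, toReal_lintegral_ofReal_add_const (hint χ) hB,
    toReal_lintegral_ofReal_add_const (hint χ') hB] at hreal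
  rw [Delta, hone, hone]
  change (_ + (M.lik χ z).toReal * B) * _ ≤ _ * (_ + (M.lik χ' z).toReal * B) + _ at hreal
  linarith

lemma abs_Delta_one_div_le (hz : M.supLkh z ≠ ∞) (hf : Measurable f) (hB : ∀ x, |f x| ≤ B)
    {τ : ℝ} (hτ : 0 ≤ τ)
    (h : ∀ χ χ' : ProbabilityMeasure X,
      (∫⁻ x, ENNReal.ofReal (f x + B) ∂M.push χ z) * M.lik χ' z ≤
        M.lik χ z * (∫⁻ x, ENNReal.ofReal (f x + B) ∂M.push χ' z) +
          ENNReal.ofReal τ * M.supLkh z ^ 2)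
    (χ χ' : ProbabilityMeasure X) :
    |M.Delta χ χ' z f (fun _ => 1)| / (M.supLkh z).toReal ^ 2 ≤ τ := by
  have hle (χ χ' : ProbabilityMeasure X) :
      M.Delta χ χ' z f (fun _ => 1) ≤ τ * (M.supLkh z).toReal ^ 2 := by
    refine (M.Delta_one_le hz hf hB (by finiteness) (h χ χ')).trans_eq ?_
    rw [ENNReal.toReal_mul, ENNReal.toReal_ofReal hτ, ENNReal.toReal_pow]
  have hneg : -M.Delta χ χ' z f (fun _ => 1) = M.Delta χ' χ z f fun _ => 1 := by
    simp only [Delta]; ring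
  exact div_le_of_le_mul₀ (sq_nonneg _) hτ (abs_le'.2 ⟨hle χ χ', hneg ▸ hle χ' χ⟩)

lemma abs_Delta_one_div_le_two_mul (hz : M.supLkh z ≠ ∞) (hf : Measurable f)
    (hB0 : 0 ≤ B) (hB : ∀ x, |f x| ≤ B) (χ χ' : ProbabilityMeasure X) :
    |M.Delta χ χ' z f (fun _ => 1)| / (M.supLkh z).toReal ^ 2 ≤ 2 * B :=
  M.abs_Delta_one_div_le hz hf hB (by positivity) (fun χ χ' =>
    (M.lintegral_ofReal_push_mul_lik_le hB χ χ').trans le_add_self) χ χ'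

end Delta

variable {M : HMM X S} {r : ℕ} {K : Set (Fin r → S)} {D : Set X} {c C₀ : ℝ} {y : ℤ → S} {ρ : ℝ≥0∞}
  {m : ℕ} {f : X → ℝ} {B : ℝ}

lemma PathControl.expE_le_rate_pow_mul_supLkh_sq (h : M.PathControl r K D c C₀ y)
    (hD : MeasurableSet D) (hne : D.Nonempty) (hr : 0 < r) (hm : 24 * r * (C₀ + 1) ≤ m) :
    expE (-(13 * ((c + 1) * m))) ≤
      ENNReal.ofReal (rate r ρ ^ m) * M.supLkh (block y (-m) m) ^ 2 := by
  have hsup := h.le_supLkh_of_long hD hne hr hm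
  have hc := h.slope_nonneg
  calc expE (-(13 * ((c + 1) * m)))
      ≤ expE (-m + (-(4 * ((c + 1) * m)) + -(4 * ((c + 1) * m)))) := expE_mono (by
        have : 0 ≤ c * m := by positivity
        have : (0 : ℝ) ≤ m := m.cast_nonneg
        linarith)
    _ = ENNReal.ofReal (Real.exp (-m)) * expE (-(4 * ((c + 1) * m))) ^ 2 := by
        rw [expE_add, expE_add, sq]; rfl
    _ ≤ _ := by gcongr; exact exp_neg_le_rate_pow r ρ m

theorem PathControl.abs_Delta_div_le_of_long (h : M.PathControl r K D c C₀ y)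
    (hD : MeasurableSet D) (hne : D.Nonempty) (hr : 0 < r)
    (hmix : M.IsMixing r K ρ (leakage r c)) (hm : 24 * r * (C₀ + 1) ≤ m) (hf : Measurable f)
    (hB0 : 0 ≤ B) (hB : ∀ x, |f x| ≤ B) (χ χ' : ProbabilityMeasure X) :
    |M.Delta χ χ' (block y (-m) m) f (fun _ => 1)| / (M.supLkh (block y (-m) m)).toReal ^ 2 ≤
      3 * (rate r ρ ^ m * (2 * B)) := by
  have hz : M.supLkh (block y (-m) m) ≠ ∞ :=
    ne_top_of_le_ne_top (h.majorant_ne_top _ _) (M.supLkh_le_majorant y (-m) m)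
  have hβ : 0 ≤ rate r ρ ^ m := pow_nonneg (rate_pos r ρ).le m
  have hfm : Measurable fun x => ENNReal.ofReal (f x + B) := (hf.add_const B).ennreal_ofReal
  refine M.abs_Delta_one_div_le hz hf hB (by positivity) (fun χ χ' => ?_) χ χ'
  obtain ⟨e, -, he, hle⟩ := h.exists_wlik_mul_le (k := 0) hr hmix hm hfm
    (b := fun _ => 1) measurable_const (s := ENNReal.ofReal (2 * B)) fun x _ => by
      rw [mul_one]; exact ENNReal.ofReal_le_ofReal (by linarith [le_of_abs_le (hB x)])
  have hρe : ρ ^ e ≤ ENNReal.ofReal (rate r ρ ^ m) :=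
    (ENNReal.le_ofReal_iff_toReal_le (ENNReal.pow_ne_top hmix.lt_one.ne_top) hβ).2
      (toReal_pow_le_rate_pow hmix.pos hmix.lt_one he)
  have hlow := h.expE_le_rate_pow_mul_supLkh_sq (ρ := ρ) hD hne hr hm
  have hlik := M.lintegral_ofReal_push_mul_lik_le (z := block y (-m) m) hB
  have hχ := hle χ χ'
  rw [measure_univ, measure_univ, mul_one, mul_one, add_zero, ← lintegral_push _ _ _ _ _ hfm,
    ← lintegral_push _ _ _ _ _ hfm, ← lik_eq_wlik, ← lik_eq_wlik] at hχ
  refine hχ.trans ?_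
  gcongr _ + ?_
  calc _ ≤ ENNReal.ofReal (rate r ρ ^ m) *
        (ENNReal.ofReal (2 * B) * M.supLkh (block y (-m) m) ^ 2 +
          ENNReal.ofReal (2 * B) * M.supLkh (block y (-m) m) ^ 2) +
        ENNReal.ofReal (rate r ρ ^ m) * M.supLkh (block y (-m) m) ^ 2 * ENNReal.ofReal (2 * B) :=
        add_le_add (mul_le_mul' hρe (add_le_add (hlik χ χ') ((mul_comm _ _).trans_le (hlik χ' χ))))
          (mul_le_mul' hlow le_rfl)
    _ = _ := by
        rw [ENNReal.ofReal_mul zero_le_three, ENNReal.ofReal_mul hβ, ENNReal.ofReal_ofNat]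
        ring

end HMM

section RandomConstants

variable {Ω E ι : Type*} [MeasurableSpace Ω] [MeasurableSpace E] {P : Measure Ω}

lemma exists_measurable_forall_le_mul_pow [Countable ι] {U : Ω → ℝ} (hU : Measurable U)
    {w : ι → ℕ} (hw : ∀ N, {i | w i ≤ N}.Finite) {β : ℝ} (hβ : 0 < β) (b : ℝ)
    {T : ι → Ω → ℝ} (hT : ∀ i, AEMeasurable (T i) P) :
    ∃ C : Ω → ℝ, Measurable C ∧ ∀ᵐ ω ∂P, b ≤ C ω ∧
      ∀ i, (w i : ℝ) < U ω → T i ω ≤ C ω * β ^ w i := by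
  let F (i : ι) : Ω → ℝ≥0∞ := {ω | (w i : ℝ) < U ω}.indicator
    fun ω => ENNReal.ofReal ((hT i).mk (T i) ω / β ^ w i)
  have hF (i : ι) : Measurable (F i) :=
    ((hT i).measurable_mk.div_const _).ennreal_ofReal.indicator
      (measurableSet_lt measurable_const hU)
  have hfin (ω : Ω) : ∑' i, F i ω ≠ ∞ := by
    obtain ⟨N, hN⟩ := exists_nat_ge (U ω)
    rw [tsum_eq_sum (s := (hw N).toFinset) fun i hi => Set.indicator_of_notMem (fun hlt =>
      hi ((hw N).mem_toFinset.2 (Nat.cast_le.1 (hlt.le.trans hN)))) _]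
    exact ENNReal.sum_ne_top.2 fun i _ =>
      ne_top_of_le_ne_top ENNReal.ofReal_ne_top (Set.indicator_apply_le fun _ => le_rfl)
  refine ⟨fun ω => max b (∑' i, F i ω).toReal,
    measurable_const.max (Measurable.tsum hF).ennreal_toReal, ?_⟩
  filter_upwards [ae_all_iff.2 fun i => (hT i).ae_eq_mk] with ω hω
  refine ⟨le_max_left _ _, fun i hi => (div_le_iff₀ (pow_pos hβ _)).1 ?_⟩
  have hFi : F i ω = ENNReal.ofReal (T i ω / β ^ w i) := by
    rw [hω i]; exact Set.indicator_of_mem (s := {ω | (w i : ℝ) < U ω}) hi _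
  exact ((ENNReal.ofReal_le_iff_le_toReal (hfin ω)).1 (hFi ▸ ENNReal.le_tsum i)).trans
    (le_max_right _ _)

variable [IsProbabilityMeasure P] {V : ℤ → Ω → E} {f : E → ℝ≥0∞}

lemma IsStationaryErgodic.exists_sum_le (h : IsStationaryErgodic P V)
    (hV : ∀ n, Measurable (V n)) (hf : AEMeasurable f (P.map (V 0))) {c : ℝ}
    (hc : ∫⁻ ω, f (V 0 ω) ∂P < ENNReal.ofReal c) :
    ∃ C : Ω → ℝ, Measurable C ∧ ∀ᵐ ω ∂P, (∀ i : ℤ, f (V i ω) < ∞) ∧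
      ∀ p q : ℕ, ∑ i ∈ Finset.range (p + q), (f (V (-p + i) ω)).toReal ≤ c * (p + q) + C ω := by
  have hpath : Measurable fun ω n => V n ω := measurable_pi_lambda _ hV
  have hf0 : AEMeasurable (fun u : ℤ → E => f (u 0)) (P.map fun ω n => V n ω) := by
    refine AEMeasurable.comp_measurable (g := f) ?_ (measurable_pi_apply 0)
    rwa [Measure.map_map (measurable_pi_apply 0) hpath]
  simpa only [shiftSeq, zero_add] using h.exists_sum_shiftSeq_le hV hf0 hc

lemma IsStationaryErgodic.exists_sum_le_of_hasFiniteExpectation (h : IsStationaryErgodic P V)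
    (hV : ∀ n, Measurable (V n)) (hf : HasFiniteExpectation P (V 0) f) :
    ∃ c : ℝ, 0 ≤ c ∧ ∃ C : Ω → ℝ, Measurable C ∧ ∀ᵐ ω ∂P, (∀ i : ℤ, f (V i ω) < ∞) ∧
      ∀ p q : ℕ, ∑ i ∈ Finset.range (p + q), (f (V (-p + i) ω)).toReal ≤ c * (p + q) + C ω :=
  ⟨(∫⁻ ω, f (V 0 ω) ∂P).toReal + 1, by positivity, h.exists_sum_le hV hf.1
    ((ENNReal.lt_ofReal_iff_toReal_lt hf.2.ne).2 (lt_add_one _))⟩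

end RandomConstants

lemma exists_badCount_le {Ω E : Type*} [MeasurableSpace Ω] [MeasurableSpace E] {P : Measure Ω}
    [IsProbabilityMeasure P] {Y : ℤ → Ω → E} {r : ℕ} {K : Set (Fin r → E)}
    (hY : ∀ n, Measurable (Y n))
    (h : IsStationaryErgodic P fun (n : ℤ) ω => block (fun j => Y j ω) (n * (r : ℤ)) r)
    (hK : MeasurableSet K) (hP : 2 / 3 < P {ω | block (fun j => Y j ω) 0 r ∈ K}) :
    ∃ U : Ω → ℝ, Measurable U ∧ ∀ᵐ ω ∂P, ∀ p q : ℕ,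
      (badCount K (fun n => Y n ω) (-p) (p + q) : ℝ) ≤ (p + q) / 3 + U ω := by
  have hV (n : ℤ) : Measurable fun ω => block (fun j => Y j ω) (n * (r : ℤ)) r :=
    (measurable_block _ _).comp (measurable_pi_lambda _ hY)
  have hKm := measurableSet_preimage (hV 0) hK
  have hint : ∫⁻ ω, Kᶜ.indicator 1 (block (fun j => Y j ω) ((0 : ℤ) * r) r) ∂P <
      ENNReal.ofReal (1 / 3) := by
    have hthirds : ENNReal.ofReal (1 / 3) + 2 / 3 = 1 := by
      rw [ENNReal.ofReal_div_of_pos zero_lt_three, ENNReal.ofReal_one, ENNReal.ofReal_ofNat,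
        ← ENNReal.add_div, add_comm, two_add_one_eq_three]
      exact ENNReal.div_self three_ne_zero ENNReal.ofNat_ne_top
    calc _ = P ((fun ω => block (fun j => Y j ω) ((0 : ℤ) * r) r) ⁻¹' K)ᶜ :=
          lintegral_indicator_one hKm.compl
      _ < ENNReal.ofReal (1 / 3) := by
          rw [prob_compl_eq_one_sub hKm, zero_mul]
          refine ENNReal.sub_lt_of_lt_add prob_le_one ?_
          exact hthirds.symm.trans_lt (ENNReal.add_lt_add_left ENNReal.ofReal_ne_top hP)
  obtain ⟨U, hU, hsum⟩ :=
    h.exists_sum_le hV (measurable_one.indicator hK.compl).aemeasurable hint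
  refine ⟨U, hU, hsum.mono fun ω hω p q => (le_of_eq ?_).trans ((hω.2 p q).trans_eq (by ring))⟩
  rw [badCount, Nat.cast_sum]
  refine Finset.sum_congr rfl fun i _ => ?_
  by_cases hi : block (fun j => Y j ω) ((-(p : ℤ) + i) * r) r ∈ K <;> simp [hi]

lemma logPlus_lt_top {a : ℝ≥0∞} (h : a ≠ ∞) : logPlus a < ∞ := by
  rw [logPlus, lt_top_iff_ne_top, ne_eq, EReal.toENNReal_eq_top_iff]
  simpa using h

lemma max_one_le_expE_logPlus {a : ℝ≥0∞} (h : logPlus a < ∞) :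
    max 1 a ≤ expE (logPlus a).toReal :=
  max_le (expE_zero ▸ expE_mono ENNReal.toReal_nonneg) (le_expE_logPlus h)

namespace HMM

variable {X S Ω : Type*} [MeasurableSpace X] [MeasurableSpace S] [MeasurableSpace Ω]
  {M : HMM X S} {P : Measure Ω} {Y : ℤ → Ω → S} {r : ℕ} {K : Set (Fin r → S)} {D : Set X}

lemma AssumptionA1.exists_isMixing (h : M.AssumptionA1 P Y r K D) {η : ℝ≥0∞} (hη : 0 < η)
    (hη' : η ≠ ∞) : ∃ ρ : ℝ≥0∞, M.IsMixing r K ρ η := by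
  lift η to ℝ≥0 using hη'
  obtain ⟨C, εm, εp, lam, φ, hC, hK, hε⟩ := h.localDoeblin η (ENNReal.coe_pos.1 hη)
  let c : ℝ≥0∞ := min (⨅ z ∈ K, (εm z : ℝ≥0∞) / (εp z : ℝ≥0∞)) (1 / 2)
  have hc0 : c ≠ 0 := (lt_min hε (by simp)).ne'
  have hc1 : c < 1 := (min_le_right _ _).trans_lt (by simp)
  have hcc : c * c < 1 := (mul_le_of_le_one_right' hc1.le).trans_lt hc1
  exact ⟨1 - c * c, tsub_pos_of_lt hcc,
    ENNReal.sub_lt_self ENNReal.one_ne_top one_ne_zero (mul_ne_zero hc0 hc0),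
    C, εm, εp, lam, φ, c, hC, fun z hz => (min_le_left _ _).trans (iInf₂_le z hz),
    fun z hz => (hK z hz).1, tsub_add_cancel_of_le hcc.le⟩

section Controls

variable [IsProbabilityMeasure P]

lemma exists_majorant_le (hY : ∀ n, Measurable (Y n)) (h : IsStationaryErgodic P Y)
    (hg : HasFiniteExpectation P (Y 0) fun y => logPlus (M.supG y)) :
    ∃ c : ℝ, 0 ≤ c ∧ ∃ U : Ω → ℝ, Measurable U ∧ ∀ᵐ ω ∂P, ∀ p q : ℕ,
      M.majorant (fun n => Y n ω) (-p) (p + q) ≤ expE (c * (p + q) + U ω) := by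
  obtain ⟨c, hc, U, hU, hsum⟩ := h.exists_sum_le_of_hasFiniteExpectation hY hg
  refine ⟨c, hc, U, hU, hsum.mono fun ω hω p q => ?_⟩
  calc M.majorant (fun n => Y n ω) (-p) (p + q)
      ≤ ∏ i ∈ Finset.range (p + q), expE (logPlus (M.supG (Y (-p + i) ω))).toReal :=
        Finset.prod_le_prod' fun i _ => max_one_le_expE_logPlus (hω.1 _)
    _ = expE (∑ i ∈ Finset.range (p + q), (logPlus (M.supG (Y (-p + i) ω))).toReal) :=
        (expE_sum _ _).symm
    _ ≤ _ := expE_mono (hω.2 p q)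

lemma exists_le_prodInf (hY : ∀ n, Measurable (Y n))
    (h : IsStationaryErgodic P fun (n : ℤ) ω => block (fun j => Y j ω) (n * (r : ℤ)) r)
    (hD : HasFiniteExpectation P (fun ω => block (fun j => Y j ω) 0 r)
      fun z => logMinus (⨅ x ∈ D, M.lkh z x D)) :
    ∃ c : ℝ, 0 ≤ c ∧ ∃ U : Ω → ℝ, Measurable U ∧ ∀ᵐ ω ∂P, ∀ p q : ℕ,
      expE (-(c * (p + q) + U ω)) ≤ M.prodInf r D (fun n => Y n ω) (-p) (p + q) := by
  have hV (n : ℤ) : Measurable fun ω => block (fun j => Y j ω) (n * (r : ℤ)) r :=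
    (measurable_block _ _).comp (measurable_pi_lambda _ hY)
  let a (ω : Ω) (i : ℤ) : ℝ≥0∞ := ⨅ x ∈ D, M.lkh (block (fun j => Y j ω) (i * r) r) x D
  obtain ⟨c, hc, U, hU, hsum⟩ :=
    h.exists_sum_le_of_hasFiniteExpectation hV (by simpa only [zero_mul] using hD)
  refine ⟨c, hc, U, hU, hsum.mono fun ω hω p q => ?_⟩
  calc expE (-(c * (p + q) + U ω))
      ≤ expE (∑ i ∈ Finset.range (p + q), -(logMinus (a ω (-p + i))).toReal) := by
        rw [Finset.sum_neg_distrib]; exact expE_mono (neg_le_neg (hω.2 p q))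
    _ = ∏ i ∈ Finset.range (p + q), expE (-(logMinus (a ω (-p + i))).toReal) := expE_sum _ _
    _ ≤ _ := Finset.prod_le_prod' fun i _ => expE_neg_logMinus_le (hω.1 _)

theorem exists_pathControl (hY : ∀ n, Measurable (Y n)) (hA1 : M.AssumptionA1 P Y r K D)
    (hA2 : M.AssumptionA2 P Y) :
    ∃ c : ℝ, ∃ U : Ω → ℝ, Measurable U ∧
      ∀ᵐ ω ∂P, M.PathControl r K D c (U ω) (fun n => Y n ω) := by
  obtain ⟨c₁, hc₁, U₁, hU₁, hmaj⟩ := exists_majorant_le hY hA1.stationaryErgodic hA2.supG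
  obtain ⟨c₂, hc₂, U₂, hU₂, hinf⟩ := exists_le_prodInf hY hA1.blockErgodic hA1.minoration
  obtain ⟨U₃, hU₃, hbad⟩ := exists_badCount_le hY hA1.blockErgodic hA1.measurableSet_K hA1.prob_K
  refine ⟨c₁ + c₂, fun ω => |U₁ ω| + |U₂ ω| + |U₃ ω|, (hU₁.abs.add hU₂.abs).add hU₃.abs, ?_⟩
  filter_upwards [hmaj, hinf, hbad] with ω hmaj hinf hbad
  have h₁ := le_abs_self (U₁ ω)
  have h₂ := le_abs_self (U₂ ω)
  have h₃ := le_abs_self (U₃ ω)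
  have hn₁ := abs_nonneg (U₁ ω)
  have hn₂ := abs_nonneg (U₂ ω)
  have hn₃ := abs_nonneg (U₃ ω)
  have hs₁ (p q : ℕ) : 0 ≤ c₁ * (p + q) := by positivity
  have hs₂ (p q : ℕ) : 0 ≤ c₂ * (p + q) := by positivity
  exact
    { slope_nonneg := add_nonneg hc₁ hc₂
      intercept_nonneg := by positivity
      majorant_le := fun p q => (hmaj p q).trans (expE_mono (by linarith [hs₂ p q]))
      le_prodInf := fun p q => (expE_mono (by linarith [hs₁ p q])).trans (hinf p q)
      badCount_le := fun p q => (hbad p q).trans (by linarith) }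

theorem exists_initControl (hY : ∀ n, Measurable (Y n)) (h : IsStationaryErgodic P Y)
    (hD : MeasurableSet D) {χ : ProbabilityMeasure X} (hχ : χ ∈ M.initClass P Y D r) :
    ∃ U : Ω → ℝ, Measurable U ∧ ∀ᵐ ω ∂P, 0 ≤ U ω ∧
      M.InitControl r D χ (U ω) (fun n => Y n ω) := by
  have hl (l : Fin (r + 1)) : ∃ U : Ω → ℝ, Measurable U ∧ ∀ᵐ ω ∂P, ∀ m : ℕ,
      logMinus (M.push χ (block (shiftSeq (-(m : ℤ)) fun n => Y n ω) 0 l) D) ≤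
        ENNReal.ofReal (1 * m + U ω) :=
    h.exists_shiftSeq_neg_le hY (f := fun u => logMinus (M.push χ (block u 0 l) D))
      (measurable_logMinus.comp ((M.measurable_push χ hD).comp (measurable_block 0 l)))
      (hχ l (Nat.lt_succ_iff.1 l.2)).ne one_pos
  choose U hU hle using hl
  refine ⟨fun ω => ∑ l, |U l ω|, Finset.measurable_sum _ fun l _ => (hU l).abs, ?_⟩
  filter_upwards [ae_all_iff.2 hle] with ω hω
  have hsum (l : Fin (r + 1)) : U l ω ≤ ∑ l, |U l ω| := (le_abs_self _).trans
    (Finset.single_le_sum (f := fun l => |U l ω|) (fun _ _ => abs_nonneg _) (Finset.mem_univ l))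
  refine ⟨by positivity, fun l hl m => expE_neg_le_of_logMinus_le (by positivity) ?_⟩
  have hlm := hω ⟨l, Nat.lt_succ_iff.2 hl⟩ m
  rw [block_shiftSeq, zero_add, one_mul] at hlm
  exact hlm.trans (ENNReal.ofReal_le_ofReal (by gcongr; exact hsum _))

end Controls

lemma supLkh_pos (hg : ∀ x y, 0 < M.g x y) [Nonempty X] (y : ℤ → S) (j : ℤ) (n : ℕ) :
    0 < M.supLkh (block y j n) :=
  let χ : ProbabilityMeasure X := ⟨Measure.dirac (Classical.arbitrary X), inferInstance⟩
  (M.lik_pos y hg χ j n).trans_le (M.lik_le_supLkh χ _)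

lemma logPredLik_block_le {y : ℤ → S} (hg : ∀ x y, 0 < M.g x y)
    (hy : ∀ j n, M.majorant y j n ≠ ∞) (χ : ProbabilityMeasure X) (m k : ℕ) :
    M.logPredLik χ (block y (-m) (m + k + 1)) ≤ (logPlus (M.supG (y k))).toReal := by
  have hplus : logPlus (M.supG (y k)) < ∞ :=
    logPlus_lt_top (ne_top_of_le_ne_top (hy k 1) (M.supG_le_majorant y k))
  have hfin (n : ℕ) : M.lik χ (block y (-m) n) ≠ ∞ :=
    ne_top_of_le_ne_top (hy _ _) (M.push_univ_le y χ (-m) n)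
  have hpos (n : ℕ) : 0 < (M.lik χ (block y (-m) n)).toReal :=
    ENNReal.toReal_pos (M.lik_pos y hg χ _ _).ne' (hfin n)
  have hle : M.lik χ (block y (-m) (m + k + 1)) ≤
      M.lik χ (block y (-m) (m + k)) * expE (logPlus (M.supG (y k))).toReal := by
    refine (M.lik_add_le y χ _ _ _).trans ?_
    rw [majorant_one, neg_natCast_add_natCast_add]
    gcongr
    exact max_one_le_expE_logPlus hplus
  rw [logPredLik, init_block, Real.log_le_iff_le_exp (div_pos (hpos _) (hpos _)),
    div_le_iff₀' (hpos _), ← toReal_expE, ← ENNReal.toReal_mul]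
  exact ENNReal.toReal_mono (ENNReal.mul_ne_top (hfin _) (expE_ne_top _)) hle

lemma measurable_logPredLik_block (hY : ∀ n, Measurable (Y n))
    (χ : ProbabilityMeasure X) (j : ℤ) (n : ℕ) :
    Measurable fun ω => M.logPredLik χ (block (fun i => Y i ω) j (n + 1)) :=
  (M.measurable_logPredLik χ).comp ((measurable_block j (n + 1)).comp (measurable_pi_lambda _ hY))

lemma finite_setOf_add_le (N : ℕ) : {i : ℕ × ℕ | i.1 + i.2 ≤ N}.Finite :=
  ((Set.finite_Iic N).prod (Set.finite_Iic N)).subset fun _ hi =>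
    ⟨(Nat.le_add_right _ _).trans hi, (Nat.le_add_left _ _).trans hi⟩

lemma aemeasurable_logPlus_supG (hY : ∀ n, Measurable (Y n)) (h : IsStationaryErgodic P Y)
    (hA2 : M.AssumptionA2 P Y) (i : ℤ) :
    AEMeasurable (fun ω => (logPlus (M.supG (Y i ω))).toReal) P :=
  ((h.map_eq hY i ▸ hA2.supG.1).comp_measurable (hY i)).ennreal_toReal

section PathControl

variable {c : ℝ} {U : Ω → ℝ} {ρ : ℝ≥0∞} {χ χ' : ProbabilityMeasure X}

theorem ae_lik_pos_lt_top_and_supLkh_pos_lt_top [Nonempty X] (hg : ∀ x y, 0 < M.g x y)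
    (hpath : ∀ᵐ ω ∂P, M.PathControl r K D c (U ω) fun n => Y n ω) :
    ∀ᵐ ω ∂P, ∀ (j : ℤ) (n : ℕ),
      (∀ χ : ProbabilityMeasure X, 0 < M.lik χ (block (fun i => Y i ω) j n) ∧
        M.lik χ (block (fun i => Y i ω) j n) < ∞) ∧
      0 < M.supLkh (block (fun i => Y i ω) j n) ∧ M.supLkh (block (fun i => Y i ω) j n) < ∞ :=
  hpath.mono fun _ h j n =>
    have hfin := (h.majorant_ne_top j n).lt_top
    ⟨fun χ => ⟨M.lik_pos _ hg χ j n, (M.push_univ_le _ χ j n).trans_lt hfin⟩,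
      supLkh_pos hg _ j n, (M.supLkh_le_majorant _ j n).trans_lt hfin⟩

variable (hD : MeasurableSet D) (hr : 0 < r) (hU : Measurable U)
  (hpath : ∀ᵐ ω ∂P, M.PathControl r K D c (U ω) fun n => Y n ω)
  (hmix : M.IsMixing r K ρ (leakage r c))

include hD hr hU hpath hmix

theorem exists_abs_Delta_div_le (hne : D.Nonempty) :
    ∃ C : Ω → ℝ, Measurable C ∧ ∀ᵐ ω ∂P, ∀ (m : ℕ) (χ χ' : ProbabilityMeasure X) (f : X → ℝ),
      Measurable f → (∃ B, ∀ x, |f x| ≤ B) →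
        |M.Delta χ χ' (block (fun i => Y i ω) (-(m : ℤ)) m) f (fun _ => 1)| /
            (M.supLkh (block (fun i => Y i ω) (-(m : ℤ)) m)).toReal ^ 2 ≤
          C ω * rate r ρ ^ m * ⨆ x, |f x| := by
  have hβ := rate_pos r ρ
  obtain ⟨C, hC, hCω⟩ := exists_measurable_forall_le_mul_pow (P := P)
    ((hU.add_const 1).const_mul (24 * r : ℝ)) Set.finite_Iic hβ 6
    fun _ : ℕ => aemeasurable_const (b := (2 : ℝ))
  refine ⟨C, hC, ?_⟩
  filter_upwards [hpath, hCω] with ω h ⟨hb, hshort⟩ m χ χ' f hf ⟨B, hB⟩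
  have hbdd : BddAbove (Set.range fun x => |f x|) := ⟨B, Set.forall_mem_range.2 hB⟩
  have hsup (x : X) : |f x| ≤ ⨆ x, |f x| := le_ciSup hbdd x
  have hsup0 : 0 ≤ ⨆ x, |f x| := Real.iSup_nonneg fun x => abs_nonneg (f x)
  rcases lt_or_ge (m : ℝ) (24 * r * (U ω + 1)) with hlt | hge
  · have hfin := ne_top_of_le_ne_top (h.majorant_ne_top _ _) (M.supLkh_le_majorant _ (-m) m)
    refine (M.abs_Delta_one_div_le_two_mul hfin hf hsup0 hsup χ χ').trans ?_
    gcongr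
    exact hshort m hlt
  · calc _ ≤ 3 * (rate r ρ ^ m * (2 * ⨆ x, |f x|)) := h.abs_Delta_div_le_of_long
          hD hne hr hmix hge hf hsup0 hsup χ χ'
      _ = 6 * rate r ρ ^ m * ⨆ x, |f x| := by ring
      _ ≤ _ := by gcongr

variable [IsProbabilityMeasure P] (hY : ∀ n, Measurable (Y n)) (hst : IsStationaryErgodic P Y)

include hY hst

theorem exists_logPredLik_sub_le (hA2 : M.AssumptionA2 P Y) (hχ : χ ∈ M.initClass P Y D r)
    (hχ' : χ' ∈ M.initClass P Y D r) :
    ∃ C : Ω → ℝ, Measurable C ∧ ∀ᵐ ω ∂P, ∀ k m : ℕ,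
      ∀ χt ∈ M.nearSet (block (fun i => Y i ω) (-(m : ℤ)) (m + k + 1)) χ,
        M.logPredLik χt (block (fun i => Y i ω) (-(m : ℤ)) (m + k + 1)) -
          M.logPredLik χ' (block (fun i => Y i ω) (-(m : ℤ)) (m + k + 1)) ≤
            C ω * rate r ρ ^ (k + m) := by
  have hβ := rate_pos r ρ
  obtain ⟨U₁, hU₁, hω₁⟩ := exists_initControl hY hst hD hχ
  obtain ⟨U₂, hU₂, hω₂⟩ := exists_initControl hY hst hD hχ'
  obtain ⟨C, hC, hCω⟩ := exists_measurable_forall_le_mul_pow (P := P)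
    ((((hU.add hU₁).add hU₂).add_const 1).const_mul (24 * r : ℝ)) finite_setOf_add_le
    hβ (4 / (1 - ρ.toReal)) fun i : ℕ × ℕ =>
      (aemeasurable_logPlus_supG hY hst hA2 i.1).sub
        (measurable_logPredLik_block (M := M) hY χ' (-i.2) (i.2 + i.1)).aemeasurable
  refine ⟨C, hC, ?_⟩
  filter_upwards [hpath, hω₁, hω₂, hCω] with ω h ⟨h₁, hχ⟩ ⟨h₂, hχ'⟩ ⟨hb, hshort⟩ k m χt hχt
  have h0 := h.intercept_nonneg
  rcases lt_or_ge ((k + m : ℕ) : ℝ) (24 * r * (U ω + U₁ ω + U₂ ω + 1)) with hlt | hge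
  · exact (sub_le_sub_right (logPredLik_block_le hA2.g_pos h.majorant_ne_top χt m k) _).trans
      (hshort (k, m) hlt)
  · refine ((h.mono (by linarith)).logPredLik_sub_le_of_long hD hr
      hA2.g_pos hmix (hχ.mono (by linarith)) (hχ'.mono (by linarith))
      (add_comm k m ▸ hge) hχt).trans ?_
    gcongr

theorem exists_abs_logPredLik_sub_le (hg : ∀ x y, 0 < M.g x y)
    (hχ : χ ∈ M.initClass P Y D r) :
    ∃ C : Ω → ℝ, Measurable C ∧ ∀ᵐ ω ∂P, ∀ k m : ℕ,
      |M.logPredLik χ (block (fun i => Y i ω) (-(m : ℤ)) (m + k + 1)) -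
        M.logPredLik χ (block (fun i => Y i ω) (-(m : ℤ) - 1) (m + k + 2))| ≤
          C ω * rate r ρ ^ (k + m) := by
  have hβ := rate_pos r ρ
  obtain ⟨U₁, hU₁, hω₁⟩ := exists_initControl hY hst hD hχ
  obtain ⟨C, hC, hCω⟩ := exists_measurable_forall_le_mul_pow (P := P)
    (((hU.add hU₁).add_const 1).const_mul (24 * r : ℝ)) finite_setOf_add_le
    hβ (4 / (1 - ρ.toReal)) fun i : ℕ × ℕ =>
      ((measurable_logPredLik_block (M := M) hY χ (-i.2) (i.2 + i.1)).sub
        (measurable_logPredLik_block (M := M) hY χ (-i.2 - 1) (i.2 + i.1 + 1))).abs.aemeasurable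
  refine ⟨C, hC, ?_⟩
  filter_upwards [hpath, hω₁, hCω] with ω h ⟨h₁, hχ⟩ ⟨hb, hshort⟩ k m
  have h0 := h.intercept_nonneg
  rcases lt_or_ge ((k + m : ℕ) : ℝ) (24 * r * (U ω + U₁ ω + 1)) with hlt | hge
  · exact hshort (k, m) hlt
  · refine ((h.mono (by linarith)).abs_logPredLik_sub_le_of_long hD hr
      hg hmix (hχ.mono (by linarith)) (add_comm k m ▸ hge)).trans ?_
    gcongr

end PathControl

end HMM

theorem mainTheorem5_general {X S Ω : Type*} [MeasurableSpace X]
    [MeasurableSpace S] [MeasurableSpace Ω] (M : HMM X S)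
    (P : Measure Ω) [IsProbabilityMeasure P] (Y : ℤ → Ω → S) (hY : ∀ n, Measurable (Y n))
    (r : ℕ) (K : Set (Fin r → S)) (D : Set X)
    (hA1 : M.AssumptionA1 P Y r K D) (hA2 : M.AssumptionA2 P Y) :
    (∀ᵐ ω ∂P, ∀ (j : ℤ) (n : ℕ),
      (∀ χ : ProbabilityMeasure X, 0 < M.lik χ (block (fun i => Y i ω) j n) ∧
        M.lik χ (block (fun i => Y i ω) j n) < ∞) ∧
      0 < M.supLkh (block (fun i => Y i ω) j n) ∧ M.supLkh (block (fun i => Y i ω) j n) < ∞) ∧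
    ∃ β : ℝ, 0 < β ∧ β < 1 ∧
      (∀ χ ∈ M.initClass P Y D r, ∀ χ' ∈ M.initClass P Y D r,
        ∃ C : Ω → ℝ, Measurable C ∧ ∀ᵐ ω ∂P, ∀ k m : ℕ,
          ∀ χt ∈ M.nearSet (block (fun i => Y i ω) (-(m : ℤ)) (m + k + 1)) χ,
            M.logPredLik χt (block (fun i => Y i ω) (-(m : ℤ)) (m + k + 1)) -
              M.logPredLik χ' (block (fun i => Y i ω) (-(m : ℤ)) (m + k + 1))
                ≤ C ω * β ^ (k + m)) ∧
      (∀ χ ∈ M.initClass P Y D r,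
        ∃ C : Ω → ℝ, Measurable C ∧ ∀ᵐ ω ∂P, ∀ k m : ℕ,
          |M.logPredLik χ (block (fun i => Y i ω) (-(m : ℤ)) (m + k + 1)) -
            M.logPredLik χ (block (fun i => Y i ω) (-(m : ℤ) - 1) (m + k + 2))|
              ≤ C ω * β ^ (k + m)) ∧
      (∃ C : Ω → ℝ, Measurable C ∧ ∀ᵐ ω ∂P, ∀ (m : ℕ)
        (χ χ' : ProbabilityMeasure X) (h : X → ℝ), Measurable h → (∃ B, ∀ x, |h x| ≤ B) →
          |M.Delta χ χ' (block (fun i => Y i ω) (-(m : ℤ)) m) h (fun _ => 1)| /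
              (M.supLkh (block (fun i => Y i ω) (-(m : ℤ)) m)).toReal ^ 2
            ≤ C ω * β ^ m * ⨆ x, |h x|) := by
  have := hA1.nonempty_D.to_subtype.map Subtype.val
  have hr := hA1.r_pos
  obtain ⟨c, U, hU, hpath⟩ := HMM.exists_pathControl hY hA1 hA2
  obtain ⟨ρ, hmix⟩ := hA1.exists_isMixing (η := HMM.leakage r c) (expE_pos _) (expE_ne_top _)
  refine ⟨HMM.ae_lik_pos_lt_top_and_supLkh_pos_lt_top hA2.g_pos hpath, HMM.rate r ρ,
    HMM.rate_pos r ρ, HMM.rate_lt_one hr hmix.lt_one, fun χ hχ χ' hχ' => ?_, fun χ hχ => ?_, ?_⟩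
  · exact HMM.exists_logPredLik_sub_le hA1.measurableSet_D hr hU hpath hmix hY
      hA1.stationaryErgodic hA2 hχ hχ'
  · exact HMM.exists_abs_logPredLik_sub_le hA1.measurableSet_D hr hU hpath hmix hY
      hA1.stationaryErgodic hA2.g_pos hχ
  · exact HMM.exists_abs_Delta_div_le hA1.measurableSet_D hr hU hpath hmix hA1.nonempty_D

theorem mainTheorem5 {X S Ω : Type*} [MeasurableSpace X] [MeasurableSpace.CountablyGenerated X]
    [MeasurableSpace S] [MeasurableSpace Ω] (M : HMM X S)
    (P : Measure Ω) [IsProbabilityMeasure P] (Y : ℤ → Ω → S) (hY : ∀ n, Measurable (Y n))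
    (r : ℕ) (K : Set (Fin r → S)) (D : Set X)
    (hA1 : M.AssumptionA1 P Y r K D) (hA2 : M.AssumptionA2 P Y) :
    -- almost surely, all the likelihoods are positive and finite
    (∀ᵐ ω ∂P, ∀ (j : ℤ) (n : ℕ),
      (∀ χ : ProbabilityMeasure X, 0 < M.lik χ (block (fun i => Y i ω) j n) ∧
        M.lik χ (block (fun i => Y i ω) j n) < ∞) ∧
      0 < M.supLkh (block (fun i => Y i ω) j n) ∧ M.supLkh (block (fun i => Y i ω) j n) < ∞) ∧
    ∃ β : ℝ, 0 < β ∧ β < 1 ∧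
      -- (i)
      (∀ χ ∈ M.initClass P Y D r, ∀ χ' ∈ M.initClass P Y D r,
        ∃ C : Ω → ℝ, Measurable C ∧ ∀ᵐ ω ∂P, ∀ k m : ℕ, 1 ≤ k →
          ∀ χt ∈ M.nearSet (block (fun i => Y i ω) (-(m : ℤ)) (m + k + 1)) χ,
            M.logPredLik χt (block (fun i => Y i ω) (-(m : ℤ)) (m + k + 1)) -
              M.logPredLik χ' (block (fun i => Y i ω) (-(m : ℤ)) (m + k + 1))
                ≤ C ω * β ^ (k + m)) ∧
      -- (ii)
      (∀ χ ∈ M.initClass P Y D r,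
        ∃ C : Ω → ℝ, Measurable C ∧ ∀ᵐ ω ∂P, ∀ k m : ℕ, 1 ≤ k →
          |M.logPredLik χ (block (fun i => Y i ω) (-(m : ℤ)) (m + k + 1)) -
            M.logPredLik χ (block (fun i => Y i ω) (-(m : ℤ) - 1) (m + k + 2))|
              ≤ C ω * β ^ (k + m)) ∧
      -- (iii)
      (∃ C : Ω → ℝ, Measurable C ∧ ∀ᵐ ω ∂P, ∀ m : ℕ, 1 ≤ m →
        ∀ (χ χ' : ProbabilityMeasure X) (h : X → ℝ), Measurable h → (∃ B, ∀ x, |h x| ≤ B) →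
          |M.Delta χ χ' (block (fun i => Y i ω) (-(m : ℤ)) m) h (fun _ => 1)| /
              (M.supLkh (block (fun i => Y i ω) (-(m : ℤ)) m)).toReal ^ 2
            ≤ C ω * β ^ m * ⨆ x, |h x|) := by
  obtain ⟨hlik, β, hβ, hβ', hi, hii, hiii⟩ := mainTheorem5_general M P Y hY r K D hA1 hA2
  refine ⟨hlik, β, hβ, hβ', fun χ hχ χ' hχ' => ?_, fun χ hχ => ?_, ?_⟩
  · exact (hi χ hχ χ' hχ').imp fun C hC => ⟨hC.1, hC.2.mono fun ω h k m _ => h k m⟩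
  · exact (hii χ hχ).imp fun C hC => ⟨hC.1, hC.2.mono fun ω h k m _ => h k m⟩
  · exact hiii.imp fun C hC => ⟨hC.1, hC.2.mono fun ω h m _ => h m⟩
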